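/- Let $\Theta\subset\mathbf R^d$ be open, $\mathcal Z\subset\mathbf R^m$, and let $\mathcal X\subset\mathbf R^p$, $\mathcal Y\subset\mathbf R^q$ be compact. Let $\zeta$ be a Borel probability measure on $\mathcal Z$, $\nu$ a Borel probability measure on $\mathcal Y$, $\lambda>0$, and let $c:\mathcal X\times\mathcal Y\to\mathbf R$ be of class $C^1$ (that is, the restriction of a $C^1$ function defined on an open neighbourhood of $\mathcal X\times\mathcal Y$). Let $g:\Theta\times\mathcal Z\to\mathcal X$, $g_\theta=g(\theta,\cdot)$, and suppose that there is $L:\Theta\times\mathcal Z\to[0,\infty)$ such that every $\theta\in\Theta$ has a neighbourhood $\Omega\subset\Theta$ with $$\|g(\theta,z)-g(\theta',z')\|\le L(\theta,z)\,\|(\theta,z)-(\theta',z')\|\qquad\text{for all }\theta'\in\Omega,\ z,z'\in\mathcal Z,$$ and such that $L(\theta):=\mathbf E_{Z\sim\zeta}[L(\theta,Z)]<\infty$ for every $\theta\in\Theta$. Define, with $\Pi(\mu,\nu)$ the set of probability measures on $\mathcal X\times\mathcal Y$ with marginals $\mu,\nu$, $$W_c^\lambda(\theta)=\mathrm{OT}_c^\lambda(g_\theta\sharp\zeta,\nu),\qquad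 \mathrm{OT}_c^\lambda(\mu,\nu)=\inf_{\pi\in\Pi(\mu,\nu)}\int c\,d\pi+\lambda H(\pi|\mu\otimes\nu),\qquad H(\pi|\mu\otimes\nu)=\int\Big(\log\frac{d\pi}{d(\mu\otimes\nu)}-1\Big)d\pi+1$$ ($H=+\infty$ if $\pi\not\ll\mu\otimes\nu$), and, for $\psi\in L^\infty(\nu)$, $$F_c^\lambda(\theta,\psi)=\mathbf E_{Z\sim\zeta}\big[\psi^{c,\lambda}(g_\theta(Z))\big]+\mathbf E_{Y\sim\nu}[\psi(Y)],\qquad \psi^{c,\lambda}(x)=-\lambda\log\int_{\mathcal Y}\exp\Big(\frac{\psi(y)-c(x,y)}{\lambda}\Big)d\nu(y).$$ Then: 1. For every $\theta\in\Theta$, $W_c^\lambda(\theta)=\max_{\psi\in L^\infty(\nu)}F_c^\lambda(\theta,\psi)$, and the maximum is attained. 2. $c$ is Lipschitz on $\mathcal X\times\mathcal Y$, and for every Lipschitz constant $\kappa$ of $c$, every $\theta_1\in\Theta$ has a neighbourhood $\Omega\subset\Theta$ such that $$|W_c^\lambda(\theta_1)-W_c^\lambda(\theta_2)|\le\kappa\,L(\theta_1)\,\|\theta_1-\theta_2\|\qquad\text{for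 all }\theta_2\in\Omega.$$ In particular, if $\theta\mapsto L(\theta)$ is locally bounded on $\Theta$, then $W_c^\lambda$ is locally Lipschitz on $\Theta$. 3. For (Lebesgue-)almost every $\theta\in\Theta$, $W_c^\lambda$ is differentiable at $\theta$ and, for every maximizer $\psi^*\in L^\infty(\nu)$ of $F_c^\lambda(\theta,\cdot)$, the function $F_c^\lambda(\cdot,\psi^*)$ is differentiable at $\theta$ and $$\nabla W_c^\lambda(\theta)=\nabla_\theta F_c^\lambda(\theta,\psi^*).$$ -/

import Mathlib

open MeasureTheory Filter Topology
open scoped ENNReal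

namespace RegOT

noncomputable section

/-- `IsC1Cost X Y c`: the cost `c : X × Y → ℝ` is of class `C¹` on the product of the (compact)
sets `X` and `Y`, i.e. it is the restriction of a function which is `C¹` on an open
neighbourhood of `X × Y`. -/
def IsC1Cost {p q : ℕ} (X : Set (EuclideanSpace ℝ (Fin p))) (Y : Set (EuclideanSpace ℝ (Fin q)))
    (c : X → Y → ℝ) : Prop :=
  ∃ (U : Set (EuclideanSpace ℝ (Fin p) × EuclideanSpace ℝ (Fin q)))
    (C : EuclideanSpace ℝ (Fin p) × EuclideanSpace ℝ (Fin q) → ℝ),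
    IsOpen U ∧ X ×ˢ Y ⊆ U ∧ ContDiffOn ℝ 1 C U ∧ ∀ (x : X) (y : Y), C (x, y) = c x y

/-- `c` is Lipschitz with constant `κ` for the Euclidean norm of the product space. -/
def IsLipschitzCost {X Y : Type*} [PseudoMetricSpace X] [PseudoMetricSpace Y]
    (c : X → Y → ℝ) (κ : ℝ) : Prop :=
  0 ≤ κ ∧ ∀ (x x' : X) (y y' : Y),
    |c x y - c x' y'| ≤ κ * Real.sqrt (dist x x' ^ 2 + dist y y' ^ 2)

/-- The regularity hypothesis on the generator `g : Θ × Z → X`, with local Lipschitz constants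
`L : Θ × Z → ℝ₊`: for every `θ ∈ Θ` there is a neighbourhood of `θ` such that for all `θ'` in it
and all `z, z'`, `‖g(θ,z) - g(θ',z')‖ ≤ L(θ,z) ‖(θ,z) - (θ',z')‖`, and `E[L(θ,Z)] < ∞`.
(The values of `g` and `L` at parameters outside the open set `Θ` play no role.) -/
structure LipschitzGenerator {d m p : ℕ} (Θ : Set (EuclideanSpace ℝ (Fin d)))
    {Z : Set (EuclideanSpace ℝ (Fin m))} {X : Set (EuclideanSpace ℝ (Fin p))}
    (ζ : Measure Z) (g : EuclideanSpace ℝ (Fin d) → Z → X)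
    (L : EuclideanSpace ℝ (Fin d) → Z → ℝ) : Prop where
  nonneg : ∀ θ ∈ Θ, ∀ z, 0 ≤ L θ z
  lipschitz : ∀ θ ∈ Θ, ∀ᶠ θ' in 𝓝 θ, ∀ z z' : Z,
    dist (g θ z) (g θ' z') ≤ L θ z * Real.sqrt (dist θ θ' ^ 2 + dist z z' ^ 2)
  integrable : ∀ θ ∈ Θ, Integrable (L θ) ζ

variable {X Y : Type*} [MeasurableSpace X] [MeasurableSpace Y]

/-- `Π(μ, ν)`: the transport plans, i.e. measures on `X × Y` with marginals `μ` and `ν`. -/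
def plans (μ : Measure X) (ν : Measure Y) : Set (Measure (X × Y)) :=
  {π | π.map Prod.fst = μ ∧ π.map Prod.snd = ν}

/-- The entropic optimal transport cost
`OT_c^λ(μ, ν) = inf_{π ∈ Π(μ, ν)} ∫ c dπ + λ H(π | μ ⊗ ν)`.
The relative entropy `∫ (log (dπ/d(μ⊗ν)) - 1) dπ + 1` is the Kullback-Leibler divergence
(both marginals being probability measures); plans of infinite entropy do not contribute to the
infimum, the cost being bounded. -/
def otReg (c : X → Y → ℝ) (lam : ℝ) (μ : Measure X) (ν : Measure Y) : ℝ :=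
  sInf {r : ℝ | ∃ π ∈ plans μ ν, InformationTheory.klDiv π (μ.prod ν) ≠ ⊤ ∧
    r = (∫ w, c w.1 w.2 ∂π) + lam * (InformationTheory.klDiv π (μ.prod ν)).toReal}

/-- The regularized transform
`ψ^{c,λ}(x) = -λ log ∫ exp((ψ(y) - c(x,y)) / λ) dν(y)`. -/
def softTransform (c : X → Y → ℝ) (lam : ℝ) (ν : Measure Y) (ψ : Y → ℝ) (x : X) : ℝ :=
  -lam * Real.log (∫ y, Real.exp ((ψ y - c x y) / lam) ∂ν)

variable {T Z : Type*} [MeasurableSpace Z]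

/-- `F_c^λ(θ, ψ) = E_{Z∼ζ}[ψ^{c,λ}(g_θ(Z))] + E_{Y∼ν}[ψ(Y)]`. -/
def dualFun (c : X → Y → ℝ) (lam : ℝ) (ζ : Measure Z) (ν : Measure Y) (g : T → Z → X)
    (θ : T) (ψ : Y → ℝ) : ℝ :=
  (∫ z, softTransform c lam ν ψ (g θ z) ∂ζ) + ∫ y, ψ y ∂ν

/-- `W_c^λ(θ) = OT_c^λ(g_θ ♯ ζ, ν)`. -/
def genCost (c : X → Y → ℝ) (lam : ℝ) (ζ : Measure Z) (ν : Measure Y) (g : T → Z → X)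
    (θ : T) : ℝ :=
  otReg c lam (ζ.map (g θ)) ν

/-- `ψ` is a Kantorovich potential at `θ`: it belongs to `L^∞(ν)` and maximizes
`F_c^λ(θ, ·)` over `L^∞(ν)`. -/
def IsKantorovichPotential (c : X → Y → ℝ) (lam : ℝ) (ζ : Measure Z) (ν : Measure Y)
    (g : T → Z → X) (θ : T) (ψ : Y → ℝ) : Prop :=
  MemLp ψ ∞ ν ∧ ∀ φ : Y → ℝ, MemLp φ ∞ ν →
    dualFun c lam ζ ν g θ φ ≤ dualFun c lam ζ ν g θ ψ

end

end RegOT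

/-! Duality. Weak duality is the Gibbs variational inequality for the reference `μ.prod ν` and the
exponent `(φ ⊕ ψ - c) / lam`, where `φ` is the transform of `ψ`, so that the exponential has total
mass one. Equality holds as soon as `φ` and `ψ` are transforms of each other: the tilted measure is
then a plan. Such a pair comes from maximizing the dual over the compact set of `κ`-Lipschitz
functions vanishing at a point. Replacing `ψ` by its double transform does not decrease the dual and
keeps it `κ`-Lipschitz, so the equality case makes a maximizer a fixed point almost everywhere
(`exists_softTransform_fixedPoint`). Weak duality then makes it optimal in all of `L^∞`.

Lipschitz estimate. Every transform is `κ`-Lipschitz, whatever `ψ` is. The estimate for `dualFun` is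
therefore uniform in `ψ` and passes to the maximum.

Gradient. The estimates hold only around each base point, with a constant depending on it, so
Stepanov's theorem replaces Rademacher's. It applies to `genCost` and to each trajectory `g · z`;
Fubini then makes almost all trajectories differentiable at almost every `θ`. There `dualFun` is
differentiable for every `ψ` at once, by dominated convergence. For a potential `ψ`, the difference
`genCost - dualFun` has a minimum at `θ`, so the gradients agree. -/

namespace RegOT

/-! ### Pointwise Lipschitz functions and Stepanov's theorem -/

section Analysis

variable {E : Type*} [NormedAddCommGroup E]

/-- The inf-convolution of `f` over `B` with the cone `k ‖·‖`. -/
noncomputable def lowerEnvelope (f : E → ℝ) (B : Set E) (k : ℕ) (x : E) : ℝ :=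
  ⨅ y : B, (f y + k * ‖x - y‖)

theorem bddBelow_lowerEnvelope {f : E → ℝ} {B : Set E} (hf : BddBelow (f '' B)) (k : ℕ) (x : E) :
    BddBelow (Set.range fun y : B => f y + k * ‖x - y‖) := by
  obtain ⟨m, hm⟩ := hf
  refine ⟨m, ?_⟩
  rintro _ ⟨y, rfl⟩
  have := hm ⟨y, y.2, rfl⟩
  have : 0 ≤ (k : ℝ) * ‖x - y‖ := by positivity
  dsimp only
  linarith

theorem lowerEnvelope_le {f : E → ℝ} {B : Set E} (hf : BddBelow (f '' B)) (k : ℕ) {x : E}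
    (hx : x ∈ B) : lowerEnvelope f B k x ≤ f x := by
  have := ciInf_le (bddBelow_lowerEnvelope hf k x) ⟨x, hx⟩
  simpa [lowerEnvelope] using this

theorem lowerEnvelope_eq {f : E → ℝ} {B : Set E} (hf : BddBelow (f '' B)) (k : ℕ) {x : E}
    (hx : x ∈ B) (h : ∀ y ∈ B, f x - f y ≤ k * ‖x - y‖) : lowerEnvelope f B k x = f x := by
  refine le_antisymm (lowerEnvelope_le hf k hx) ?_
  have : Nonempty B := ⟨⟨x, hx⟩⟩
  refine le_ciInf fun y => ?_
  have := h y y.2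
  linarith

theorem lipschitzWith_lowerEnvelope {f : E → ℝ} {B : Set E} (hf : BddBelow (f '' B)) (k : ℕ) :
    LipschitzWith k (lowerEnvelope f B k) := by
  refine LipschitzWith.of_le_add_mul _ fun x x' => ?_
  -- A real infimum over the empty set is `0`, so the envelope is then constant.
  rcases isEmpty_or_nonempty B with hB | hB
  · simp only [lowerEnvelope, Real.iInf_of_isEmpty]
    positivity
  rw [← sub_le_iff_le_add]
  refine le_ciInf fun y => ?_
  have h1 := ciInf_le (bddBelow_lowerEnvelope hf k x) y
  have h2 : ‖x - y‖ ≤ ‖x' - y‖ + dist x x' := by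
    rw [dist_eq_norm]
    have := norm_add_le (x' - (y : E)) (x - x')
    simpa [add_comm] using this
  have h3 := mul_le_mul_of_nonneg_left h2 (Nat.cast_nonneg (α := ℝ) k)
  simp only [lowerEnvelope, NNReal.coe_natCast] at h1 ⊢
  linarith

variable [NormedSpace ℝ E]

/-- A function which is pointwise Lipschitz with constant `K` at every point of a convex set is
Lipschitz with constant `K` on this set. -/
theorem abs_sub_le_of_pointwise {s : Set E} (hs : Convex ℝ s) {f : E → ℝ} {K : ℝ}
    (h : ∀ x ∈ s, ∀ᶠ y in 𝓝 x, |f x - f y| ≤ K * ‖x - y‖) {a b : E} (ha : a ∈ s) (hb : b ∈ s) :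
    f b - f a ≤ K * ‖b - a‖ := by
  set γ : ℝ → E := fun t => a + t • (b - a) with hγ
  have hγc : Continuous γ := by fun_prop
  have hγs : ∀ t ∈ Set.Icc (0 : ℝ) 1, γ t ∈ s := fun t ht =>
    hs.add_smul_sub_mem ha hb ht
  have hev : ∀ t ∈ Set.Icc (0 : ℝ) 1, ∀ᶠ u in 𝓝 t,
      |f (γ t) - f (γ u)| ≤ K * ‖b - a‖ * |u - t| := by
    intro t ht
    filter_upwards [hγc.continuousAt.eventually (h _ (hγs t ht))] with u hu
    have : γ t - γ u = (t - u) • (b - a) := by simp only [hγ]; module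
    rw [this, norm_smul, Real.norm_eq_abs, abs_sub_comm t u] at hu
    linarith
  have hcont : ContinuousOn (fun t => f (γ t)) (Set.Icc 0 1) := by
    intro t ht
    refine ContinuousAt.continuousWithinAt ?_
    rw [ContinuousAt, tendsto_iff_norm_sub_tendsto_zero]
    refine squeeze_zero' (Eventually.of_forall fun _ => norm_nonneg _)
      (g := fun u => K * ‖b - a‖ * |u - t|) ?_ ?_
    · filter_upwards [hev t ht] with u hu
      rw [Real.norm_eq_abs, abs_sub_comm]
      exact hu
    · have : Continuous (fun u => K * ‖b - a‖ * |u - t|) := by fun_prop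
      simpa using this.tendsto t
  -- This mean value inequality only asks for a bound on the right slopes, so `f` need not be
  -- differentiable along the segment.
  have key := image_le_of_liminf_slope_right_le_deriv_boundary
    (f := fun t => f (γ t)) (a := 0) (b := 1)
    (B := fun t => f a + K * ‖b - a‖ * t) (B' := fun _ => K * ‖b - a‖)
    hcont (by simp [hγ]) (by fun_prop) (fun t _ => by
      have := ((hasDerivAt_id t).const_mul (K * ‖b - a‖)).const_add (f a)
      simpa using this.hasDerivWithinAt) (fun t ht r hr => by
      refine Eventually.frequently ?_
      have h1 := (hev t ⟨ht.1, ht.2.le⟩).filter_mono (nhdsWithin_le_nhds (s := Set.Ioi t))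
      filter_upwards [h1, self_mem_nhdsWithin] with u hu hut
      have hut' : 0 < u - t := sub_pos.2 hut
      rw [slope_def_field]
      refine lt_of_le_of_lt ?_ hr
      rw [div_le_iff₀ hut']
      rw [abs_of_pos hut'] at hu
      have := neg_abs_le (f (γ t) - f (γ u))
      linarith) (x := 1) ⟨zero_le_one, le_rfl⟩
  simp only [hγ, one_smul, add_sub_cancel, mul_one] at key
  linarith

/-- A function squeezed between two functions which are differentiable and agree at a point is
differentiable at this point. -/
theorem differentiableAt_of_squeeze {f u v : E → ℝ} {a : E} (hu : DifferentiableAt ℝ u a)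
    (hv : DifferentiableAt ℝ v a) (hua : u a = f a) (hva : v a = f a)
    (huf : ∀ᶠ x in 𝓝 a, u x ≤ f x) (hfv : ∀ᶠ x in 𝓝 a, f x ≤ v x) : DifferentiableAt ℝ f a := by
  have hmin : IsLocalMin (fun x => v x - u x) a := by
    filter_upwards [huf, hfv] with x h1 h2
    rw [hua, hva]
    linarith
  have hd : fderiv ℝ v a = fderiv ℝ u a := by
    have := hmin.fderiv_eq_zero
    rw [fderiv_fun_sub hv hu, sub_eq_zero] at this
    exact this
  refine HasFDerivAt.differentiableAt (f' := fderiv ℝ u a) ?_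
  have h1 := hu.hasFDerivAt
  have h2 := hv.hasFDerivAt
  rw [hd] at h2
  rw [hasFDerivAt_iff_isLittleO] at h1 h2 ⊢
  rw [Asymptotics.isLittleO_iff] at h1 h2 ⊢
  intro ε hε
  filter_upwards [h1 hε, h2 hε, huf, hfv] with x h3 h4 h5 h6
  rw [hua] at h3
  rw [hva] at h4
  rw [Real.norm_eq_abs] at h3 h4 ⊢
  rw [abs_le] at h3 h4 ⊢
  constructor <;> linarith [h3.1, h4.2]

/-- **Stepanov's theorem** for real-valued functions: a function is differentiable at almost every
point at which it is pointwise Lipschitz. -/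
theorem ae_differentiableAt_of_pointwise_lipschitz [FiniteDimensional ℝ E] [MeasurableSpace E]
    [BorelSpace E] (μ : Measure E) [μ.IsAddHaarMeasure] (f : E → ℝ) :
    ∀ᵐ a ∂μ, (∃ K : ℝ, ∀ᶠ x in 𝓝 a, |f a - f x| ≤ K * ‖a - x‖) → DifferentiableAt ℝ f a := by
  obtain ⟨s, s_count, s_dense⟩ := TopologicalSpace.exists_countable_dense E
  have := s_count.to_subtype
  -- Countably many balls and slopes suffice, so Rademacher's theorem for the envelopes of `f` and
  -- of `-f` costs a single null set.
  have hall : ∀ᵐ a ∂μ, ∀ (i : s × ℕ × ℕ),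
      (BddBelow (f '' Metric.ball i.1 (1 / (i.2.1 + 1 : ℝ))) →
        DifferentiableAt ℝ (lowerEnvelope f (Metric.ball i.1 (1 / (i.2.1 + 1 : ℝ))) i.2.2) a) ∧
      (BddBelow ((fun x => -f x) '' Metric.ball i.1 (1 / (i.2.1 + 1 : ℝ))) →
        DifferentiableAt ℝ
          (lowerEnvelope (fun x => -f x) (Metric.ball i.1 (1 / (i.2.1 + 1 : ℝ))) i.2.2) a) := by
    rw [ae_all_iff]
    intro i
    refine Eventually.and ?_ ?_
    · by_cases h : BddBelow (f '' Metric.ball i.1 (1 / (i.2.1 + 1 : ℝ)))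
      · filter_upwards [(lipschitzWith_lowerEnvelope h i.2.2).ae_differentiableAt] with a ha _
        exact ha
      · exact Eventually.of_forall fun a ha => absurd ha h
    · by_cases h : BddBelow ((fun x => -f x) '' Metric.ball i.1 (1 / (i.2.1 + 1 : ℝ)))
      · filter_upwards [(lipschitzWith_lowerEnvelope h i.2.2).ae_differentiableAt] with a ha _
        exact ha
      · exact Eventually.of_forall fun a ha => absurd ha h
  filter_upwards [hall] with a ha ⟨K, hK⟩
  obtain ⟨ε, hε, hball⟩ := Metric.eventually_nhds_iff_ball.1 hK
  -- With radius below `ε / 2`, any such ball containing `a` lies in the ball of radius `ε` about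
  -- `a`.
  obtain ⟨n, hn⟩ := exists_nat_one_div_lt (half_pos hε)
  have hn0 : (0 : ℝ) < 1 / (n + 1) := by positivity
  obtain ⟨p, hps, hp⟩ := s_dense.exists_dist_lt a hn0
  obtain ⟨k, hk⟩ := exists_nat_ge K
  set B := Metric.ball p (1 / (n + 1 : ℝ)) with hB
  have haB : a ∈ B := by rwa [hB, Metric.mem_ball]
  have hBn : B ∈ 𝓝 a := Metric.isOpen_ball.mem_nhds haB
  have hBK : ∀ x ∈ B, |f a - f x| ≤ k * ‖a - x‖ := by
    intro x hx
    have hx' : x ∈ Metric.ball a ε := by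
      rw [hB, Metric.mem_ball] at hx
      rw [Metric.mem_ball]
      have := dist_triangle_right x a p
      linarith
    exact (hball x hx').trans (mul_le_mul_of_nonneg_right hk (norm_nonneg _))
  have hBε : ∀ x ∈ B, |f a - f x| ≤ k * ε := by
    intro x hx
    refine (hBK x hx).trans (mul_le_mul_of_nonneg_left ?_ (Nat.cast_nonneg k))
    rw [hB, Metric.mem_ball] at hx
    rw [← dist_eq_norm]
    have := dist_triangle_right a x p
    linarith
  have hlow : BddBelow (f '' B) := by
    refine ⟨f a - k * ε, ?_⟩
    rintro _ ⟨x, hx, rfl⟩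
    have := (abs_le.1 (hBε x hx)).2
    linarith
  have hup : BddBelow ((fun x => -f x) '' B) := by
    refine ⟨-f a - k * ε, ?_⟩
    rintro _ ⟨x, hx, rfl⟩
    have := (abs_le.1 (hBε x hx)).1
    dsimp only
    linarith
  have hda := ha (⟨p, hps⟩, n, k)
  -- The two envelopes enclose `f` on `B` and touch it at `a`, because the slope `k` is at least
  -- `K`.
  refine differentiableAt_of_squeeze (hda.1 hlow) (hda.2 hup).fun_neg ?_ ?_ ?_ ?_
  · exact lowerEnvelope_eq hlow k haB fun y hy => (le_abs_self _).trans (hBK y hy)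
  · rw [lowerEnvelope_eq hup k haB fun y hy => ?_, neg_neg]
    refine le_trans ?_ (hBK y hy)
    have := neg_abs_le (f a - f y)
    linarith
  · filter_upwards [hBn] with x hx using lowerEnvelope_le hlow k hx
  · filter_upwards [hBn] with x hx
    have := lowerEnvelope_le hup k hx
    linarith

/-- Stepanov's theorem for maps into a Euclidean space. -/
theorem ae_differentiableAt_of_pointwise_lipschitz_euclidean [FiniteDimensional ℝ E]
    [MeasurableSpace E] [BorelSpace E] (μ : Measure E) [μ.IsAddHaarMeasure] {p : ℕ}
    (f : E → EuclideanSpace ℝ (Fin p)) :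
    ∀ᵐ a ∂μ, (∃ K : ℝ, ∀ᶠ x in 𝓝 a, ‖f a - f x‖ ≤ K * ‖a - x‖) → DifferentiableAt ℝ f a := by
  have h : ∀ᵐ a ∂μ, ∀ i, (∃ K : ℝ, ∀ᶠ x in 𝓝 a, |f a i - f x i| ≤ K * ‖a - x‖) →
      DifferentiableAt ℝ (fun x => f x i) a :=
    ae_all_iff.2 fun i => ae_differentiableAt_of_pointwise_lipschitz μ fun x => f x i
  filter_upwards [h] with a ha ⟨K, hK⟩
  rw [differentiableAt_euclidean]
  intro i
  refine ha i ⟨K, ?_⟩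
  filter_upwards [hK] with x hx
  refine le_trans ?_ hx
  simpa using PiLp.norm_apply_le (f a - f x) i

end Analysis

/-! ### The regularized transform -/

section SoftTransform

variable {X X' Y : Type*} [MeasurableSpace Y] {lam : ℝ} {ν : Measure Y}

theorem ae_abs_le_of_memLp_top {u : Y → ℝ} (hu : MemLp u ∞ ν) :
    ∃ B : ℝ, ∀ᵐ y ∂ν, |u y| ≤ B := by
  refine ⟨(eLpNormEssSup u ν).toReal, ?_⟩
  have h : eLpNormEssSup u ν ≠ ∞ := by
    have := hu.2.ne
    rwa [eLpNorm_exponent_top] at this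
  filter_upwards [ae_le_eLpNormEssSup (f := u) (μ := ν)] with y hy
  have := ENNReal.toReal_mono h hy
  simpa using this

theorem softTransform_congr_ae {c : X → Y → ℝ} {ψ φ : Y → ℝ} (h : ψ =ᵐ[ν] φ) (x : X) :
    softTransform c lam ν ψ x = softTransform c lam ν φ x := by
  unfold softTransform
  rw [integral_congr_ae (g := fun y => Real.exp ((φ y - c x y) / lam))]
  filter_upwards [h] with y hy
  rw [hy]

variable [IsProbabilityMeasure ν]

theorem integrable_exp_div {u : Y → ℝ} (hu : MemLp u ∞ ν) (lam : ℝ) :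
    Integrable (fun y => Real.exp (u y / lam)) ν := by
  obtain ⟨B, hB⟩ := ae_abs_le_of_memLp_top hu
  refine Integrable.of_bound (C := Real.exp (B / |lam|))
    (Real.continuous_exp.comp_aestronglyMeasurable (by
      simpa [div_eq_mul_inv] using hu.1.mul_const lam⁻¹)) ?_
  filter_upwards [hB] with y hy
  rw [Real.norm_eq_abs, Real.abs_exp, Real.exp_le_exp]
  refine (le_abs_self _).trans ?_
  rw [abs_div]
  gcongr

theorem integral_exp_div_pos {u : Y → ℝ} (hu : MemLp u ∞ ν) (lam : ℝ) :
    0 < ∫ y, Real.exp (u y / lam) ∂ν :=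
  integral_exp_pos (integrable_exp_div hu lam)

theorem exp_neg_softTransform_div {c : X → Y → ℝ} {ψ : Y → ℝ} {x : X} (hlam : 0 < lam)
    (h : MemLp (fun y => ψ y - c x y) ∞ ν) :
    Real.exp (-softTransform c lam ν ψ x / lam) = ∫ y, Real.exp ((ψ y - c x y) / lam) ∂ν := by
  have : -softTransform c lam ν ψ x / lam = Real.log (∫ y, Real.exp ((ψ y - c x y) / lam) ∂ν) := by
    unfold softTransform
    field_simp
  rw [this, Real.exp_log (integral_exp_div_pos h lam)]

/-- The transform is the normalizing constant that turns the Gibbs kernel at `x` into a probability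
density in `y`. -/
theorem integral_exp_softTransform {c : X → Y → ℝ} {ψ : Y → ℝ} {x : X} (hlam : 0 < lam)
    (h : MemLp (fun y => ψ y - c x y) ∞ ν) :
    ∫ y, Real.exp ((softTransform c lam ν ψ x + ψ y - c x y) / lam) ∂ν = 1 := by
  have h1 : ∀ y, Real.exp ((softTransform c lam ν ψ x + ψ y - c x y) / lam)
      = Real.exp (softTransform c lam ν ψ x / lam) * Real.exp ((ψ y - c x y) / lam) := by
    intro y
    rw [← Real.exp_add]
    ring_nf
  simp_rw [h1]
  rw [integral_const_mul, ← exp_neg_softTransform_div hlam h, ← Real.exp_add]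
  simp [neg_div]

/-- The transform depends only on `ψ - c x`, is decreasing in it and commutes with constants up to
sign. Letting the point, the cost and the potential all vary yields at once its Lipschitz bound in
`x`, its nonexpansiveness in `ψ` and its behaviour under shifts. -/
theorem softTransform_le_add {c : X → Y → ℝ} {c' : X' → Y → ℝ} {ψ ψ' : Y → ℝ} {x : X} {x' : X'}
    {r : ℝ} (hlam : 0 < lam) (h : MemLp (fun y => ψ y - c x y) ∞ ν)
    (h' : MemLp (fun y => ψ' y - c' x' y) ∞ ν)
    (hle : ∀ᵐ y ∂ν, ψ' y - c' x' y ≤ ψ y - c x y + r) :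
    softTransform c lam ν ψ x ≤ softTransform c' lam ν ψ' x' + r := by
  have h1 : ∫ y, Real.exp ((ψ' y - c' x' y) / lam) ∂ν
      ≤ Real.exp (r / lam) * ∫ y, Real.exp ((ψ y - c x y) / lam) ∂ν := by
    rw [← integral_const_mul]
    refine integral_mono_ae (integrable_exp_div h' lam) ((integrable_exp_div h lam).const_mul _) ?_
    filter_upwards [hle] with y hy
    rw [← Real.exp_add, Real.exp_le_exp, ← add_div]
    gcongr
    linarith
  have h2 := Real.log_le_log (integral_exp_div_pos h' lam) h1
  rw [Real.log_mul (Real.exp_pos _).ne' (integral_exp_div_pos h lam).ne', Real.log_exp] at h2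
  have h3 := mul_le_mul_of_nonneg_left h2 hlam.le
  rw [mul_add, mul_div_cancel₀ _ hlam.ne'] at h3
  unfold softTransform
  linarith

theorem abs_softTransform_sub_le {c : X → Y → ℝ} {c' : X' → Y → ℝ} {ψ ψ' : Y → ℝ} {x : X} {x' : X'}
    {r : ℝ} (hlam : 0 < lam) (h : MemLp (fun y => ψ y - c x y) ∞ ν)
    (h' : MemLp (fun y => ψ' y - c' x' y) ∞ ν)
    (hle : ∀ᵐ y ∂ν, |(ψ y - c x y) - (ψ' y - c' x' y)| ≤ r) :
    |softTransform c lam ν ψ x - softTransform c' lam ν ψ' x'| ≤ r := by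
  have h1 := softTransform_le_add (r := r) hlam h h' (by
    filter_upwards [hle] with y hy
    linarith [(abs_le.1 hy).1])
  have h2 := softTransform_le_add (r := r) hlam h' h (by
    filter_upwards [hle] with y hy
    linarith [(abs_le.1 hy).2])
  rw [abs_le]
  constructor <;> linarith

theorem softTransform_add_const {c : X → Y → ℝ} {ψ : Y → ℝ} {x : X} (hlam : 0 < lam)
    (h : MemLp (fun y => ψ y - c x y) ∞ ν) (a : ℝ) :
    softTransform c lam ν (fun y => ψ y + a) x = softTransform c lam ν ψ x - a := by
  have h' : MemLp (fun y => ψ y + a - c x y) ∞ ν := by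
    have := h.add (memLp_const a)
    refine this.congr_norm ?_ ?_
    · exact (this.1.congr (Eventually.of_forall fun y => by simp; ring))
    · exact Eventually.of_forall fun y => by simp; ring_nf
  have h1 := softTransform_le_add (r := a) hlam h h' (Eventually.of_forall fun y => by linarith)
  have h2 := softTransform_le_add (r := -a) hlam h' h (Eventually.of_forall fun y => by linarith)
  linarith

end SoftTransform

/-! ### The Gibbs variational principle -/

section Gibbs

open InformationTheory

variable {Ω : Type*} [MeasurableSpace Ω] {ρ π : Measure Ω} [IsProbabilityMeasure ρ]

/-- The Gibbs variational inequality. -/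
theorem integral_sub_log_le_klDiv [IsProbabilityMeasure π] {h : Ω → ℝ} (hπ : Integrable h π)
    (hρ : Integrable (fun w => Real.exp (h w)) ρ) (hkl : klDiv π ρ ≠ ⊤) :
    ∫ w, h w ∂π - Real.log (∫ w, Real.exp (h w) ∂ρ) ≤ (klDiv π ρ).toReal := by
  obtain ⟨hac, hint⟩ := klDiv_ne_top_iff.1 hkl
  have hprob : IsProbabilityMeasure (ρ.tilted h) := isProbabilityMeasure_tilted hρ
  have hac' : π ≪ ρ.tilted h := hac.trans (absolutelyContinuous_tilted hρ)
  -- The gap in the inequality is exactly the divergence of `π` from the tilted measure, which is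
  -- nonnegative.
  have h1 := toReal_klDiv_of_measure_eq hac' (by simp)
  rw [integral_llr_tilted_right hac hπ hρ hint] at h1
  rw [toReal_klDiv_of_measure_eq hac (by simp)]
  have : 0 ≤ (klDiv π (ρ.tilted h)).toReal := ENNReal.toReal_nonneg
  linarith

/-- The Gibbs variational inequality is an equality at the tilted measure. -/
theorem klDiv_tilted {h : Ω → ℝ} (hρ : Integrable (fun w => Real.exp (h w)) ρ)
    (hint : Integrable h (ρ.tilted h)) :
    klDiv (ρ.tilted h) ρ ≠ ⊤ ∧ (klDiv (ρ.tilted h) ρ).toReal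
      = ∫ w, h w ∂(ρ.tilted h) - Real.log (∫ w, Real.exp (h w) ∂ρ) := by
  have hprob : IsProbabilityMeasure (ρ.tilted h) := isProbabilityMeasure_tilted hρ
  have hac := tilted_absolutelyContinuous ρ h
  have hllr : llr (ρ.tilted h) ρ =ᵐ[ρ.tilted h]
      fun w => h w - Real.log (∫ w, Real.exp (h w) ∂ρ) :=
    hac.ae_le (log_rnDeriv_tilted_left_self hρ)
  refine ⟨klDiv_ne_top hac ?_, ?_⟩
  · rw [integrable_congr hllr]
    exact hint.sub (integrable_const _)
  · rw [toReal_klDiv_of_measure_eq hac (by simp), integral_congr_ae hllr,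
      integral_sub hint (integrable_const _)]
    simp

end Gibbs

/-! ### Weak duality, and strong duality from a pair of conjugate potentials -/

section Duality

open InformationTheory

variable {X Y : Type*} [MetricSpace X] [CompactSpace X] [MeasurableSpace X] [BorelSpace X]
  [MetricSpace Y] [CompactSpace Y] [MeasurableSpace Y] [BorelSpace Y]
  {c : X → Y → ℝ} {lam κ : ℝ} {μ : Measure X} {ν : Measure Y}

theorem _root_.Continuous.memLp_top_of_compactSpace {u : Y → ℝ} (hu : Continuous u)
    (ν : Measure Y) : MemLp u ∞ ν := by
  obtain ⟨C, hC⟩ := (isCompact_range hu).isBounded.exists_norm_le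
  exact memLp_top_of_bound hu.aestronglyMeasurable C
    (Eventually.of_forall fun y => hC _ ⟨y, rfl⟩)

theorem memLp_sub_cost {S : Type*} [TopologicalSpace S] {c : S → Y → ℝ}
    (hc : Continuous (Function.uncurry c)) {ψ : Y → ℝ} (hψ : MemLp ψ ∞ ν) (x : S) : MemLp (fun y => ψ y - c x y) ∞ ν :=
  hψ.sub ((hc.comp (Continuous.prodMk_right x)).memLp_top_of_compactSpace ν)

theorem memLp_exponent (hc : Continuous (Function.uncurry c)) {π : Measure (X × Y)}
    [IsProbabilityMeasure π]
    (h1 : π.map Prod.fst = μ) (h2 : π.map Prod.snd = ν) {φ : X → ℝ} {ψ : Y → ℝ}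
    (hφ : MemLp φ ∞ μ) (hψ : MemLp ψ ∞ ν) :
    MemLp (fun w : X × Y => φ w.1 + ψ w.2 - c w.1 w.2) ∞ π :=
  ((hφ.comp_measurePreserving ⟨measurable_fst, h1⟩).add
    (hψ.comp_measurePreserving ⟨measurable_snd, h2⟩)).sub (hc.memLp_top_of_compactSpace π)

theorem integral_exponent (hc : Continuous (Function.uncurry c)) {π : Measure (X × Y)}
    [IsProbabilityMeasure π]
    (h1 : π.map Prod.fst = μ) (h2 : π.map Prod.snd = ν) {φ : X → ℝ} {ψ : Y → ℝ}
    (hφ : MemLp φ ∞ μ) (hψ : MemLp ψ ∞ ν) :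
    ∫ w, (φ w.1 + ψ w.2 - c w.1 w.2) ∂π
      = ∫ x, φ x ∂μ + ∫ y, ψ y ∂ν - ∫ w, c w.1 w.2 ∂π := by
  have i1 : Integrable (fun w : X × Y => φ w.1) π :=
    (hφ.comp_measurePreserving (μ := π) ⟨measurable_fst, h1⟩).integrable le_top
  have i2 : Integrable (fun w : X × Y => ψ w.2) π :=
    (hψ.comp_measurePreserving (μ := π) ⟨measurable_snd, h2⟩).integrable le_top
  have i3 := (hc.memLp_top_of_compactSpace π).integrable le_top
  have e1 : ∫ w, φ w.1 ∂π = ∫ x, φ x ∂μ := by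
    rw [← h1, integral_map measurable_fst.aemeasurable]
    rw [h1]; exact hφ.1
  have e2 : ∫ w, ψ w.2 ∂π = ∫ y, ψ y ∂ν := by
    rw [← h2, integral_map measurable_snd.aemeasurable]
    rw [h2]; exact hψ.1
  rw [← e1, ← e2, ← integral_add i1 i2]
  exact integral_sub (i1.add i2) i3

variable [IsProbabilityMeasure μ] [IsProbabilityMeasure ν]

theorem memLp_exponent_prod (hc : Continuous (Function.uncurry c)) {φ : X → ℝ} {ψ : Y → ℝ}
    (hφ : MemLp φ ∞ μ) (hψ : MemLp ψ ∞ ν) :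
    MemLp (fun w : X × Y => φ w.1 + ψ w.2 - c w.1 w.2) ∞ (μ.prod ν) :=
  memLp_exponent hc measurePreserving_fst.map_eq measurePreserving_snd.map_eq hφ hψ

theorem integral_exp_softTransform_prod (hc : Continuous (Function.uncurry c)) (hlam : 0 < lam)
    {ψ : Y → ℝ} (hφ : MemLp (softTransform c lam ν ψ) ∞ μ) (hψ : MemLp ψ ∞ ν) :
    ∫ w : X × Y, Real.exp ((softTransform c lam ν ψ w.1 + ψ w.2 - c w.1 w.2) / lam) ∂(μ.prod ν)
      = 1 := by
  rw [integral_prod _ (integrable_exp_div (memLp_exponent_prod hc hφ hψ) lam)]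
  simp [integral_exp_softTransform hlam (memLp_sub_cost hc hψ _)]

/-- Weak duality. -/
theorem dual_le_primal (hc : Continuous (Function.uncurry c)) (hlam : 0 < lam)
    {ψ : Y → ℝ} (hφ : MemLp (softTransform c lam ν ψ) ∞ μ) (hψ : MemLp ψ ∞ ν)
    {π : Measure (X × Y)} (hπ : π ∈ plans μ ν) (hkl : klDiv π (μ.prod ν) ≠ ⊤) :
    ∫ x, softTransform c lam ν ψ x ∂μ + ∫ y, ψ y ∂ν
      ≤ ∫ w, c w.1 w.2 ∂π + lam * (klDiv π (μ.prod ν)).toReal := by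
  obtain ⟨h1, h2⟩ := hπ
  have hprob : IsProbabilityMeasure π := by
    have : IsProbabilityMeasure (π.map Prod.fst) := by rw [h1]; infer_instance
    exact Measure.isProbabilityMeasure_of_map (Prod.fst : X × Y → X)
  have hm := (memLp_exponent hc h1 h2 hφ hψ)
  have key := integral_sub_log_le_klDiv ((hm.integrable le_top).div_const lam)
    (integrable_exp_div (memLp_exponent_prod hc hφ hψ) lam) hkl
  rw [integral_exp_softTransform_prod hc hlam hφ hψ, Real.log_one, sub_zero, integral_div,
    integral_exponent hc h1 h2 hφ hψ, div_le_iff₀ hlam] at key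
  linarith

/-- The measure with density `exp ((φ ⊕ ψ - c) / lam)` is a plan, when each of `φ` and `ψ` is the
regularized transform of the other one. -/
theorem tilted_mem_plans (hc : Continuous (Function.uncurry c)) (hlam : 0 < lam)
    {φ : X → ℝ} {ψ : Y → ℝ} (hφ : MemLp φ ∞ μ) (hψ : MemLp ψ ∞ ν)
    (hφψ : φ = softTransform c lam ν ψ) (hψφ : ψ = softTransform (fun y x => c x y) lam μ φ) :
    (μ.prod ν).tilted (fun w => (φ w.1 + ψ w.2 - c w.1 w.2) / lam) ∈ plans μ ν := by
  have hc' : Continuous (Function.uncurry fun y x => c x y) := hc.comp continuous_swap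
  have hm := memLp_exponent_prod hc hφ hψ
  have hone : ∫ w : X × Y, Real.exp ((φ w.1 + ψ w.2 - c w.1 w.2) / lam) ∂(μ.prod ν) = 1 := by
    subst hφψ
    exact integral_exp_softTransform_prod hc hlam hφ hψ
  -- The density is normalized in each variable separately: integrating out `y` leaves `μ`,
  -- integrating out `x` leaves `ν`.
  have hx : ∀ x, ∫⁻ y, ENNReal.ofReal (Real.exp ((φ x + ψ y - c x y) / lam)) ∂ν = 1 := by
    intro x
    have hmx : MemLp (fun y => φ x + ψ y - c x y) ∞ ν :=
      ((memLp_const (φ x)).add hψ).sub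
        ((hc.comp (Continuous.prodMk_right x)).memLp_top_of_compactSpace ν)
    rw [← ofReal_integral_eq_lintegral_ofReal (integrable_exp_div hmx lam)
      (Eventually.of_forall fun y => (Real.exp_pos _).le), hφψ,
      integral_exp_softTransform hlam (memLp_sub_cost hc hψ x), ENNReal.ofReal_one]
  have hy : ∀ y, ∫⁻ x, ENNReal.ofReal (Real.exp ((φ x + ψ y - c x y) / lam)) ∂μ = 1 := by
    intro y
    have hmy : MemLp (fun x => φ x + ψ y - c x y) ∞ μ :=
      (hφ.add (memLp_const (ψ y))).sub
        ((hc'.comp (Continuous.prodMk_right y)).memLp_top_of_compactSpace μ)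
    rw [← ofReal_integral_eq_lintegral_ofReal (integrable_exp_div hmy lam)
      (Eventually.of_forall fun y => (Real.exp_pos _).le), hψφ,
      ← ENNReal.ofReal_one, ← integral_exp_softTransform (c := fun y x => c x y) hlam (memLp_sub_cost hc' hφ y)]
    simp only [add_comm]
  have haem : AEMeasurable (fun w : X × Y =>
      ENNReal.ofReal (Real.exp ((φ w.1 + ψ w.2 - c w.1 w.2) / lam))) (μ.prod ν) :=
    (integrable_exp_div hm lam).1.aemeasurable.ennreal_ofReal
  constructor
  · ext A hA
    rw [Measure.map_apply measurable_fst hA, tilted_apply' _ _ (measurable_fst hA), hone]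
    simp only [div_one]
    rw [← Set.prod_univ, setLIntegral_prod _ (by simpa using haem.restrict)]
    simp [hx]
  · ext A hA
    rw [Measure.map_apply measurable_snd hA, tilted_apply' _ _ (measurable_snd hA), hone]
    simp only [div_one]
    rw [← Set.univ_prod, setLIntegral_prod_symm _ (by simpa using haem.restrict)]
    simp [hy]

/-- Strong duality, given a pair of potentials each of which is the transform of the other one. -/
theorem isLeast_primal (hc : Continuous (Function.uncurry c)) (hlam : 0 < lam)
    {φ : X → ℝ} {ψ : Y → ℝ} (hφ : MemLp φ ∞ μ) (hψ : MemLp ψ ∞ ν)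
    (hφψ : φ = softTransform c lam ν ψ) (hψφ : ψ = softTransform (fun y x => c x y) lam μ φ) :
    IsLeast {r : ℝ | ∃ π ∈ plans μ ν, klDiv π (μ.prod ν) ≠ ⊤ ∧
      r = (∫ w, c w.1 w.2 ∂π) + lam * (klDiv π (μ.prod ν)).toReal}
      (∫ x, softTransform c lam ν ψ x ∂μ + ∫ y, ψ y ∂ν) := by
  have hφ' : MemLp (softTransform c lam ν ψ) ∞ μ := hφψ ▸ hφ
  refine ⟨?_, ?_⟩
  · have hmem := tilted_mem_plans hc hlam hφ hψ hφψ hψφ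
    have hm := memLp_exponent_prod hc hφ hψ
    have hexp := integrable_exp_div hm lam
    have hprob : IsProbabilityMeasure
        ((μ.prod ν).tilted (fun w => (φ w.1 + ψ w.2 - c w.1 w.2) / lam)) :=
      isProbabilityMeasure_tilted hexp
    have hmπ := memLp_exponent hc hmem.1 hmem.2 hφ hψ
    obtain ⟨hne, heq⟩ := klDiv_tilted hexp ((hmπ.integrable le_top).div_const lam)
    refine ⟨_, hmem, hne, ?_⟩
    have hone : ∫ w : X × Y, Real.exp ((φ w.1 + ψ w.2 - c w.1 w.2) / lam) ∂(μ.prod ν) = 1 := by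
      rw [hφψ]
      exact integral_exp_softTransform_prod hc hlam hφ' hψ
    rw [heq, hone, Real.log_one, sub_zero, integral_div,
      integral_exponent hc hmem.1 hmem.2 hφ hψ, mul_div_cancel₀ _ hlam.ne', ← hφψ]
    ring
  · rintro r ⟨π, hπ, hkl, rfl⟩
    exact dual_le_primal hc hlam hφ' hψ hπ hkl

/-- Iterating the regularized transform increases the integral of the potential, and strictly so
unless the potential is unchanged. -/
theorem integral_le_integral_softTransform_softTransform
    (hc : Continuous (Function.uncurry c)) (hlam : 0 < lam) {φ : X → ℝ} {ψ ψ' : Y → ℝ}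
    (hφ : MemLp φ ∞ μ) (hψ : MemLp ψ ∞ ν) (hψ' : MemLp ψ' ∞ ν)
    (hφψ : φ = softTransform c lam ν ψ) (hψφ : ψ' = softTransform (fun y x => c x y) lam μ φ) :
    ∫ y, ψ y ∂ν ≤ ∫ y, ψ' y ∂ν ∧ (∫ y, ψ' y ∂ν = ∫ y, ψ y ∂ν → ψ =ᵐ[ν] ψ') := by
  have hc' : Continuous (Function.uncurry fun y x => c x y) := hc.comp continuous_swap
  have hone : ∫ w : X × Y, Real.exp ((φ w.1 + ψ w.2 - c w.1 w.2) / lam) ∂(μ.prod ν) = 1 := by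
    subst hφψ
    exact integral_exp_softTransform_prod hc hlam hφ hψ
  rw [integral_prod_symm _ (integrable_exp_div (memLp_exponent_prod hc hφ hψ) lam)] at hone
  have hin : ∀ y, ∫ x, Real.exp ((φ x + ψ y - c x y) / lam) ∂μ
      = Real.exp ((ψ y - ψ' y) / lam) := by
    intro y
    have h1 := exp_neg_softTransform_div (c := fun y x => c x y) hlam (memLp_sub_cost hc' hφ y)
    have h2 : ∀ x, Real.exp ((φ x + ψ y - c x y) / lam)
        = Real.exp (ψ y / lam) * Real.exp ((φ x - c x y) / lam) := by
      intro x
      rw [← Real.exp_add]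
      ring_nf
    simp_rw [h2]
    rw [integral_const_mul, ← h1, ← hψφ, ← Real.exp_add]
    ring_nf
  simp_rw [hin] at hone
  have hd := hψ.sub hψ'
  have hi1 := hψ.integrable le_top
  have hi2 := hψ'.integrable le_top
  have hi3 : Integrable (fun y => (ψ y - ψ' y) / lam) ν := (hi1.sub hi2).div_const lam
  have hi4 : Integrable (fun y => Real.exp ((ψ y - ψ' y) / lam)) ν := integrable_exp_div hd lam
  -- Since `exp ((ψ - ψ') / lam)` has mean one, `t + 1 ≤ exp t` gives the inequality, and its
  -- strictness for `t ≠ 0` the equality case.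
  have hnn : ∀ y, 0 ≤ Real.exp ((ψ y - ψ' y) / lam) - ((ψ y - ψ' y) / lam + 1) := fun y =>
    sub_nonneg.2 (Real.add_one_le_exp _)
  have hi5 : Integrable (fun y => (ψ y - ψ' y) / lam + 1) ν := hi3.add (integrable_const (1 : ℝ))
  have hint : ∫ y, (Real.exp ((ψ y - ψ' y) / lam) - ((ψ y - ψ' y) / lam + 1)) ∂ν
      = (∫ y, ψ' y ∂ν - ∫ y, ψ y ∂ν) / lam := by
    rw [integral_sub hi4 hi5, hone, integral_add hi3 (integrable_const _), integral_div,
      integral_sub hi1 hi2]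
    simp
    ring
  refine ⟨?_, fun heq => ?_⟩
  · have := integral_nonneg_of_ae (μ := ν) (Eventually.of_forall hnn)
    rw [hint, div_nonneg_iff] at this
    rcases this with h | h <;> linarith [h.1, h.2]
  · rw [heq, sub_self, zero_div, integral_eq_zero_iff_of_nonneg hnn (hi4.sub hi5)] at hint
    filter_upwards [hint] with y hy
    by_contra hne
    have : (ψ y - ψ' y) / lam ≠ 0 := div_ne_zero (sub_ne_zero.2 hne) hlam.ne'
    have := Real.add_one_lt_exp this
    simp only [Pi.zero_apply] at hy
    linarith

end Duality

/-! ### Existence of conjugate potentials by compactness -/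

section Existence

open InformationTheory BoundedContinuousFunction

variable {X Y : Type*} [MetricSpace X] [MetricSpace Y] {c : X → Y → ℝ} {lam κ : ℝ}

theorem IsLipschitzCost.swap (hc : IsLipschitzCost c κ) : IsLipschitzCost (fun y x => c x y) κ :=
  ⟨hc.1, fun y y' x x' => by rw [add_comm]; exact hc.2 x x' y y'⟩

theorem IsLipschitzCost.left (hc : IsLipschitzCost c κ) (x x' : X) (y : Y) :
    |c x y - c x' y| ≤ κ * dist x x' := by
  have := hc.2 x x' y y
  simpa [Real.sqrt_sq dist_nonneg] using this

theorem IsLipschitzCost.continuous (hc : IsLipschitzCost c κ) :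
    Continuous (Function.uncurry c) := by
  -- The product carries the maximum distance; each coordinate contributes one `κ`.
  refine (LipschitzWith.of_dist_le' (K := κ + κ) fun w w' => ?_).continuous
  have h1 := hc.left w.1 w'.1 w.2
  have h2 := hc.swap.left w.2 w'.2 w'.1
  have h3 : κ * dist w.1 w'.1 ≤ κ * dist w w' :=
    mul_le_mul_of_nonneg_left (le_max_left _ _) hc.1
  have h4 : κ * dist w.2 w'.2 ≤ κ * dist w w' :=
    mul_le_mul_of_nonneg_left (le_max_right _ _) hc.1
  have h5 := abs_sub_le (c w.1 w.2) (c w'.1 w.2) (c w'.1 w'.2)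
  rw [Real.dist_eq]
  dsimp only [Function.uncurry] at *
  linarith

variable [CompactSpace Y]

/-- The `κ`-Lipschitz functions vanishing at a point form a compact set. -/
theorem isCompact_lipschitz_vanishing (κ : ℝ) (y₀ : Y) :
    IsCompact {f : Y →ᵇ ℝ | f y₀ = 0 ∧ ∀ y y', |f y - f y'| ≤ κ * dist y y'} := by
  refine arzela_ascoli₂ (Metric.closedBall 0 (|κ| * Metric.diam (Set.univ : Set Y)))
    (isCompact_closedBall _ _) _ ?_ ?_ ?_
  · have h : ∀ y : Y, Continuous fun f : Y →ᵇ ℝ => f y := fun y => continuous_eval_const y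
    have heq : {f : Y →ᵇ ℝ | f y₀ = 0 ∧ ∀ y y', |f y - f y'| ≤ κ * dist y y'}
        = {f : Y →ᵇ ℝ | f y₀ = 0} ∩ ⋂ y, ⋂ y', {f : Y →ᵇ ℝ | |f y - f y'| ≤ κ * dist y y'} := by
      ext f
      simp
    rw [heq]
    exact (isClosed_eq (h y₀) continuous_const).inter <| isClosed_iInter fun y =>
      isClosed_iInter fun y' => isClosed_le ((h y).sub (h y')).abs continuous_const
  · rintro f y ⟨h0, hf⟩
    have h1 := hf y y₀
    rw [h0, sub_zero] at h1
    rw [mem_closedBall_zero_iff, Real.norm_eq_abs]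
    refine h1.trans (mul_le_mul (le_abs_self κ) ?_ dist_nonneg (abs_nonneg κ))
    exact Metric.dist_le_diam_of_mem isCompact_univ.isBounded (Set.mem_univ _) (Set.mem_univ _)
  · refine Metric.equicontinuous_of_continuity_modulus (fun t => κ * t) ?_ _ fun y y' f => ?_
    · have : Continuous fun t : ℝ => κ * t := by fun_prop
      simpa using this.tendsto 0
    · rw [Real.dist_eq]
      exact f.2.2 y y'

variable [MeasurableSpace Y] [BorelSpace Y] {ν : Measure Y}
  [IsProbabilityMeasure ν]

theorem abs_softTransform_sub_le_dist (hc : IsLipschitzCost c κ) (hlam : 0 < lam) {ψ : Y → ℝ}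
    (hψ : MemLp ψ ∞ ν) (x x' : X) :
    |softTransform c lam ν ψ x - softTransform c lam ν ψ x'| ≤ κ * dist x x' := by
  refine abs_softTransform_sub_le hlam (memLp_sub_cost hc.continuous hψ x)
    (memLp_sub_cost hc.continuous hψ x') (Eventually.of_forall fun y => ?_)
  have := hc.left x' x y
  rw [dist_comm] at this
  convert this using 2
  ring

theorem continuous_softTransform (hc : IsLipschitzCost c κ) (hlam : 0 < lam) {ψ : Y → ℝ}
    (hψ : MemLp ψ ∞ ν) : Continuous (softTransform c lam ν ψ) :=
  (LipschitzWith.of_dist_le' (K := κ) fun x x' => by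
    rw [Real.dist_eq]; exact abs_softTransform_sub_le_dist hc hlam hψ x x').continuous

variable [CompactSpace X] [MeasurableSpace X] [BorelSpace X] {μ : Measure X}

theorem memLp_softTransform (hc : IsLipschitzCost c κ) (hlam : 0 < lam) {ψ : Y → ℝ}
    (hψ : MemLp ψ ∞ ν) : MemLp (softTransform c lam ν ψ) ∞ μ :=
  (continuous_softTransform hc hlam hψ).memLp_top_of_compactSpace μ

variable [IsProbabilityMeasure μ]

theorem continuous_dual (hc : IsLipschitzCost c κ) (hlam : 0 < lam) :
    Continuous fun f : Y →ᵇ ℝ => ∫ x, softTransform c lam ν f x ∂μ + ∫ y, f y ∂ν := by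
  have hm : ∀ f : Y →ᵇ ℝ, MemLp f ∞ ν := fun f => f.continuous.memLp_top_of_compactSpace ν
  refine Continuous.add ?_ ?_
  · refine (LipschitzWith.of_dist_le' (K := 1) fun f g => ?_).continuous
    rw [dist_eq_norm, ← integral_sub ((memLp_softTransform hc hlam (hm f)).integrable le_top)
      ((memLp_softTransform hc hlam (hm g)).integrable le_top)]
    refine (norm_integral_le_of_norm_le_const (C := dist f g)
      (Eventually.of_forall fun x => ?_)).trans (by simp)
    refine abs_softTransform_sub_le hlam (memLp_sub_cost hc.continuous (hm f) x)
      (memLp_sub_cost hc.continuous (hm g) x) (Eventually.of_forall fun y => ?_)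
    have := dist_coe_le_dist (f := f) (g := g) y
    rw [Real.dist_eq] at this
    convert this using 2
    ring
  · refine (LipschitzWith.of_dist_le' (K := 1) fun f g => ?_).continuous
    rw [dist_eq_norm, ← integral_sub ((hm f).integrable le_top) ((hm g).integrable le_top)]
    refine (norm_integral_le_of_norm_le_const (C := dist f g)
      (Eventually.of_forall fun y => ?_)).trans (by simp)
    rw [← dist_eq_norm]
    exact dist_coe_le_dist (f := f) (g := g) y

/-- Existence of a pair of potentials each of which is the regularized transform of the other
one. -/
theorem exists_softTransform_fixedPoint (hc : IsLipschitzCost c κ) (hlam : 0 < lam)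
    (μ : Measure X) [IsProbabilityMeasure μ] (ν : Measure Y) [IsProbabilityMeasure ν] :
    ∃ (φ : X → ℝ) (ψ : Y → ℝ), MemLp φ ∞ μ ∧ MemLp ψ ∞ ν ∧
      φ = softTransform c lam ν ψ ∧ ψ = softTransform (fun y x => c x y) lam μ φ := by
  have hne : Nonempty Y := nonempty_of_isProbabilityMeasure ν
  obtain ⟨y₀⟩ := hne
  obtain ⟨f, ⟨-, -⟩, hmax⟩ := (isCompact_lipschitz_vanishing κ y₀).exists_isMaxOn
    ⟨0, by simp, fun y y' => by simpa using mul_nonneg hc.1 dist_nonneg⟩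
    (continuous_dual (μ := μ) (ν := ν) hc hlam).continuousOn
  have hf : MemLp f ∞ ν := f.continuous.memLp_top_of_compactSpace ν
  set φ := softTransform c lam ν f with hφ_def
  have hφ : MemLp φ ∞ μ := memLp_softTransform hc hlam hf
  set ψ := softTransform (fun y x => c x y) lam μ φ with hψ_def
  have hψc : Continuous ψ := continuous_softTransform hc.swap hlam hφ
  have hψ : MemLp ψ ∞ ν := memLp_softTransform hc.swap hlam hφ
  have hφ' : MemLp (softTransform c lam ν ψ) ∞ μ := memLp_softTransform hc hlam hψ
  obtain ⟨h1, h1'⟩ := integral_le_integral_softTransform_softTransform hc.continuous hlam hφ hf hψ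
    hφ_def hψ_def
  -- By `h1` and `h2` neither term of the dual decreases from `f` to `ψ`. The dual is invariant
  -- under constants, so `ψ - ψ y₀` is a competitor of `f`, and maximality forces equality in `h1`.
  obtain ⟨h2, -⟩ := integral_le_integral_softTransform_softTransform hc.swap.continuous hlam hψ hφ
    hφ' hψ_def rfl
  have hgc : Continuous fun y => ψ y + -ψ y₀ := hψc.add continuous_const
  have h3 := hmax (a := mkOfCompact ⟨_, hgc⟩) ⟨by simp, fun y y' => by
    simpa using abs_softTransform_sub_le_dist hc.swap hlam hφ y y'⟩
  have h4 : ∀ x, softTransform c lam ν (fun y => ψ y + -ψ y₀) x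
      = softTransform c lam ν ψ x - -ψ y₀ := fun x =>
    softTransform_add_const hlam (memLp_sub_cost hc.continuous hψ x) _
  simp only [Set.mem_ofPred_eq, mkOfCompact_apply, ContinuousMap.coe_mk] at h3
  have h5 : ⇑(mkOfCompact ⟨fun y => ψ y + -ψ y₀, hgc⟩) = fun y => ψ y + -ψ y₀ := rfl
  rw [h5] at h3
  simp_rw [h4] at h3
  rw [integral_sub (hφ'.integrable le_top) (integrable_const _),
    integral_add (hψ.integrable le_top) (integrable_const _)] at h3
  simp only [integral_const, probReal_univ, one_smul] at h3
  have h6 := h1' (by linarith)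
  refine ⟨φ, ψ, hφ, hψ, ?_, hψ_def⟩
  ext x
  -- The transform sees only the `ν`-class of its argument, so an almost everywhere fixed point
  -- gives an identity at every `x`.
  exact softTransform_congr_ae h6 x

/-- Duality for the entropic optimal transport, with attainment. -/
theorem isGreatest_otReg (hc : IsLipschitzCost c κ) (hlam : 0 < lam)
    (μ : Measure X) [IsProbabilityMeasure μ] (ν : Measure Y) [IsProbabilityMeasure ν] :
    IsGreatest {r : ℝ | ∃ ψ : Y → ℝ, MemLp ψ ∞ ν ∧
      ∫ x, softTransform c lam ν ψ x ∂μ + ∫ y, ψ y ∂ν = r} (otReg c lam μ ν) := by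
  obtain ⟨φ, ψ, hφ, hψ, h1, h2⟩ := exists_softTransform_fixedPoint hc hlam μ ν
  have h := isLeast_primal hc.continuous hlam hφ hψ h1 h2
  have heq : otReg c lam μ ν = _ := h.csInf_eq
  refine ⟨⟨ψ, hψ, heq.symm⟩, ?_⟩
  rintro _ ⟨ψ', hψ', rfl⟩
  obtain ⟨π, hπ, hkl, hr⟩ := h.1
  rw [heq, hr]
  exact dual_le_primal hc.continuous hlam (memLp_softTransform hc hlam hψ') hψ' hπ hkl

end Existence

/-! ### Consequences of the smoothness of the cost -/

section C1

variable {p q : ℕ}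

theorem exists_lipschitzOnWith_of_contDiffOn {E F : Type*} [NormedAddCommGroup E]
    [NormedSpace ℝ E] [NormedAddCommGroup F] [NormedSpace ℝ F] {f : E → F} {U S : Set E}
    (hU : IsOpen U) (hf : ContDiffOn ℝ 1 f U) (hS : IsCompact S) (hSU : S ⊆ U) :
    ∃ K, LipschitzOnWith K f S := by
  refine LocallyLipschitzOn.exists_lipschitzOnWith_of_compact hS fun x hx => ?_
  obtain ⟨K, t, ht, h⟩ :=
    ((hf x (hSU hx)).contDiffAt (hU.mem_nhds (hSU hx))).exists_lipschitzOnWith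
  exact ⟨K, t, mem_nhdsWithin_of_mem_nhds ht, h⟩

theorem IsC1Cost.exists_isLipschitzCost {X : Set (EuclideanSpace ℝ (Fin p))} (hX : IsCompact X)
    {Y : Set (EuclideanSpace ℝ (Fin q))} (hY : IsCompact Y) {c : X → Y → ℝ}
    (hc : IsC1Cost X Y c) : ∃ κ, IsLipschitzCost c κ := by
  obtain ⟨U, C, hU, hXY, hC, hCc⟩ := hc
  obtain ⟨K, hK⟩ := exists_lipschitzOnWith_of_contDiffOn hU hC (hX.prod hY) hXY
  refine ⟨K, K.2, fun x x' y y' => ?_⟩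
  have h := hK.dist_le_mul (x.1, y.1) ⟨x.2, y.2⟩ (x'.1, y'.1) ⟨x'.2, y'.2⟩
  rw [hCc, hCc, Real.dist_eq] at h
  -- The Euclidean distance on the product dominates the maximum distance.
  refine h.trans (mul_le_mul_of_nonneg_left (max_le ?_ ?_) K.2)
  · exact Real.le_sqrt_of_sq_le (le_add_of_nonneg_right (sq_nonneg _))
  · exact Real.le_sqrt_of_sq_le (le_add_of_nonneg_left (sq_nonneg _))

/-- The regularized transform is, near every point, the restriction of a function which is
differentiable at this point. -/
theorem IsC1Cost.exists_differentiableAt_softTransform {X : Set (EuclideanSpace ℝ (Fin p))}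
    {Y : Set (EuclideanSpace ℝ (Fin q))} (hY : IsCompact Y) {c : X → Y → ℝ}
    (hc : IsC1Cost X Y c) {lam : ℝ} {ν : Measure Y} [IsProbabilityMeasure ν] {ψ : Y → ℝ}
    (hψ : MemLp ψ ∞ ν) (x₀ : X) :
    ∃ Ψ : EuclideanSpace ℝ (Fin p) → ℝ, DifferentiableAt ℝ Ψ x₀ ∧
      ∀ x : X, Ψ x = softTransform c lam ν ψ x := by
  have : CompactSpace Y := isCompact_iff_compactSpace.1 hY
  obtain ⟨U, C, hU, hXY, hC, hCc⟩ := hc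
  -- Factoring the exponential isolates the `C¹` part `G` from `exp (ψ / lam)`, which is only
  -- bounded and measurable in `y`.
  set G : EuclideanSpace ℝ (Fin p) × EuclideanSpace ℝ (Fin q) → ℝ :=
    fun w => Real.exp (-C w / lam) with hG_def
  have hG : ContDiffOn ℝ 1 G U := (hC.neg.div_const lam).exp
  have hGd : ∀ w ∈ U, HasFDerivAt G (fderiv ℝ G w) w := fun w hw =>
    ((hG.differentiableOn one_ne_zero).differentiableAt (hU.mem_nhds hw)).hasFDerivAt
  have hG' : ContinuousOn (fderiv ℝ G) U := hG.continuousOn_fderiv_of_isOpen hU le_rfl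
  -- The tube lemma gives one ball about `x₀` valid for all `y`; compactness then gives one
  -- Lipschitz constant of `G`, which dominates the difference quotients.
  obtain ⟨u, v, hu, hv, hxu, hYv, huv⟩ :=
    generalized_tube_lemma (isCompact_singleton (x := (x₀ : EuclideanSpace ℝ (Fin p)))) hY hU
      (fun w hw => hXY ⟨by rw [hw.1]; exact x₀.2, hw.2⟩)
  obtain ⟨ε, hε, hball⟩ := Metric.nhds_basis_closedBall.mem_iff.1
    (hu.mem_nhds (hxu (Set.mem_singleton _)))
  have hsub : ∀ x ∈ Metric.closedBall (x₀ : EuclideanSpace ℝ (Fin p)) ε, ∀ y : Y,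
      (x, (y : EuclideanSpace ℝ (Fin q))) ∈ U := fun x hx y => huv ⟨hball hx, hYv y.2⟩
  obtain ⟨K, hK⟩ := exists_lipschitzOnWith_of_contDiffOn hU hG
    ((isCompact_closedBall (x₀ : EuclideanSpace ℝ (Fin p)) ε).prod hY)
    (fun w hw => hsub w.1 hw.1 ⟨w.2, hw.2⟩)
  have hx₀ : (x₀ : EuclideanSpace ℝ (Fin p)) ∈ Metric.closedBall (x₀ : EuclideanSpace ℝ (Fin p)) ε :=
    Metric.mem_closedBall_self hε.le
  have hslice : ∀ x : EuclideanSpace ℝ (Fin p), Continuous fun y : Y =>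
      (x, (y : EuclideanSpace ℝ (Fin q))) := fun x => by fun_prop
  have hGc : ∀ x ∈ Metric.closedBall (x₀ : EuclideanSpace ℝ (Fin p)) ε,
      Continuous fun y : Y => G (x, y) := fun x hx =>
    hG.continuousOn.comp_continuous (hslice x) (hsub x hx)
  have hexp := integrable_exp_div hψ lam
  have hint : ∀ x ∈ Metric.closedBall (x₀ : EuclideanSpace ℝ (Fin p)) ε,
      Integrable (fun y : Y => Real.exp (ψ y / lam) * G (x, y)) ν := fun x hx =>
    hexp.mul_of_top_left ((hGc x hx).memLp_top_of_compactSpace ν)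
  have hderiv := hasFDerivAt_integral_of_dominated_loc_of_lip' (μ := ν) (𝕜 := ℝ)
    (F := fun x y => Real.exp (ψ y / lam) * G (x, y))
    (F' := fun y => Real.exp (ψ y / lam) • (fderiv ℝ G (x₀, y)).comp
      (ContinuousLinearMap.inl ℝ _ _))
    (bound := fun y => Real.exp (ψ y / lam) * K) (x₀ := (x₀ : EuclideanSpace ℝ (Fin p)))
    (Metric.closedBall_mem_nhds _ hε) (fun x hx => (hint x hx).1) (hint x₀ hx₀)
    (by
      refine hexp.1.smul (Continuous.aestronglyMeasurable ?_)
      exact (hG'.comp_continuous (hslice x₀) (hsub x₀ hx₀)).clm_comp continuous_const)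
    (Eventually.of_forall fun y x hx => by
      have h := hK.dist_le_mul (x, (y : EuclideanSpace ℝ (Fin q))) ⟨hx, y.2⟩
        ((x₀ : EuclideanSpace ℝ (Fin p)), (y : EuclideanSpace ℝ (Fin q))) ⟨hx₀, y.2⟩
      rw [Prod.dist_eq, dist_self, max_eq_left dist_nonneg, dist_eq_norm, dist_eq_norm] at h
      rw [← mul_sub, norm_mul, Real.norm_eq_abs, Real.abs_exp, mul_assoc]
      exact mul_le_mul_of_nonneg_left h (Real.exp_pos _).le)
    (hexp.mul_const _)
    (Eventually.of_forall fun y => by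
      have h1 : HasFDerivAt (fun x => (x, (y : EuclideanSpace ℝ (Fin q))))
          (ContinuousLinearMap.inl ℝ _ _) (x₀ : EuclideanSpace ℝ (Fin p)) :=
        hasFDerivAt_prodMk_left _ _
      exact ((hGd (x₀, y) (hsub x₀ hx₀ y)).comp (x₀ : EuclideanSpace ℝ (Fin p)) h1).const_mul _)
  have hpos : 0 < ∫ y, Real.exp (ψ y / lam) * G (x₀, y) ∂ν := by
    have heq : ∀ y : Y, Real.exp (ψ y / lam) * G (x₀, y)
        = Real.exp (ψ y / lam + -C (x₀, y) / lam) := fun y => by rw [Real.exp_add]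
    have := hint x₀ hx₀
    simp_rw [heq] at this ⊢
    exact integral_exp_pos this
  refine ⟨fun x => -lam * Real.log (∫ y, Real.exp (ψ y / lam) * G (x, y) ∂ν),
    (hderiv.2.differentiableAt.log hpos.ne').const_mul _, fun x => ?_⟩
  simp only [softTransform, hG_def, ← Real.exp_add, hCc]
  congr 3
  ext y
  ring_nf

end C1

/-! ### Estimates for the generator, the dual functional and the cost -/

section Generator

variable {d m p : ℕ} {Θ : Set (EuclideanSpace ℝ (Fin d))} {Z : Set (EuclideanSpace ℝ (Fin m))}
  {X : Set (EuclideanSpace ℝ (Fin p))} {ζ : Measure Z} {g : EuclideanSpace ℝ (Fin d) → Z → X}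
  {L : EuclideanSpace ℝ (Fin d) → Z → ℝ}

/-- The constant is frozen at the base point and the neighbourhood is uniform in `z'`, hence
continuity in both variables jointly, as later measurability arguments require. -/
theorem LipschitzGenerator.continuousAt (hg : LipschitzGenerator Θ ζ g L)
    {θ : EuclideanSpace ℝ (Fin d)} (hθ : θ ∈ Θ) (z : Z) :
    ContinuousAt (fun w : Z × EuclideanSpace ℝ (Fin d) => g w.2 w.1) (z, θ) := by
  rw [ContinuousAt, tendsto_iff_dist_tendsto_zero]
  have hev : ∀ᶠ w : Z × EuclideanSpace ℝ (Fin d) in 𝓝 (z, θ), ∀ z z' : Z,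
      dist (g θ z) (g w.2 z') ≤ L θ z * Real.sqrt (dist θ w.2 ^ 2 + dist z z' ^ 2) :=
    (continuous_snd.tendsto (z, θ)).eventually (hg.lipschitz θ hθ)
  refine squeeze_zero' (Eventually.of_forall fun _ => dist_nonneg)
    (g := fun w => L θ z * Real.sqrt (dist θ w.2 ^ 2 + dist z w.1 ^ 2)) ?_ ?_
  · filter_upwards [hev] with w hw
    rw [dist_comm]
    exact hw z w.1
  · have : Continuous fun w : Z × EuclideanSpace ℝ (Fin d) =>
        L θ z * Real.sqrt (dist θ w.2 ^ 2 + dist z w.1 ^ 2) := by fun_prop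
    simpa using this.tendsto (z, θ)

theorem LipschitzGenerator.continuous (hg : LipschitzGenerator Θ ζ g L)
    {θ : EuclideanSpace ℝ (Fin d)} (hθ : θ ∈ Θ) : Continuous (g θ) :=
  continuous_iff_continuousAt.2 fun z =>
    (hg.continuousAt hθ z).comp (f := fun z => (z, θ)) (by fun_prop)

theorem LipschitzGenerator.eventually_dist_le (hg : LipschitzGenerator Θ ζ g L)
    {θ : EuclideanSpace ℝ (Fin d)} (hθ : θ ∈ Θ) :
    ∀ᶠ θ' in 𝓝 θ, ∀ z, dist (g θ z) (g θ' z) ≤ L θ z * ‖θ - θ'‖ := by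
  filter_upwards [hg.lipschitz θ hθ] with θ' h z
  have := h z z
  simpa [Real.sqrt_sq dist_nonneg, dist_eq_norm] using this

section Cost

variable {Y : Type*} [MetricSpace Y] [CompactSpace Y] [MeasurableSpace Y] [BorelSpace Y]
  {ν : Measure Y} [IsProbabilityMeasure ν] {c : X → Y → ℝ} {lam κ : ℝ}

/-- The neighbourhood is chosen before `ψ`; this uniformity lets the estimate pass to the maximum
over `ψ`. -/
theorem LipschitzGenerator.eventually_softTransform_sub_le
    (hg : LipschitzGenerator Θ ζ g L) (hc : IsLipschitzCost c κ) (hlam : 0 < lam)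
    {θ : EuclideanSpace ℝ (Fin d)} (hθ : θ ∈ Θ) :
    ∀ᶠ θ' in 𝓝 θ, ∀ ψ : Y → ℝ, MemLp ψ ∞ ν → ∀ z,
      |softTransform c lam ν ψ (g θ z) - softTransform c lam ν ψ (g θ' z)|
        ≤ κ * L θ z * ‖θ - θ'‖ := by
  filter_upwards [hg.eventually_dist_le hθ] with θ' h ψ hψ z
  rw [mul_assoc]
  exact (abs_softTransform_sub_le_dist hc hlam hψ _ _).trans
    (mul_le_mul_of_nonneg_left (h z) hc.1)

variable [IsProbabilityMeasure ζ]

theorem LipschitzGenerator.integrable_softTransform [CompactSpace X]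
    (hg : LipschitzGenerator Θ ζ g L) (hc : IsLipschitzCost c κ) (hlam : 0 < lam)
    {θ : EuclideanSpace ℝ (Fin d)} (hθ : θ ∈ Θ) {ψ : Y → ℝ} (hψ : MemLp ψ ∞ ν) :
    Integrable (fun z => softTransform c lam ν ψ (g θ z)) ζ := by
  have := (hg.continuous hθ).measurable
  have h := memLp_softTransform (μ := ζ.map (g θ)) hc hlam hψ
  have : IsProbabilityMeasure (ζ.map (g θ)) := Measure.isProbabilityMeasure_map this.aemeasurable
  exact (h.integrable le_top).comp_measurable (hg.continuous hθ).measurable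

/-- Duality for the cost of a generator. -/
theorem LipschitzGenerator.isGreatest_genCost [CompactSpace X]
    (hg : LipschitzGenerator Θ ζ g L) (hc : IsLipschitzCost c κ) (hlam : 0 < lam)
    {θ : EuclideanSpace ℝ (Fin d)} (hθ : θ ∈ Θ) :
    IsGreatest {r : ℝ | ∃ ψ : Y → ℝ, MemLp ψ ∞ ν ∧ dualFun c lam ζ ν g θ ψ = r}
      (genCost c lam ζ ν g θ) := by
  have hm := (hg.continuous hθ).measurable
  have : IsProbabilityMeasure (ζ.map (g θ)) := Measure.isProbabilityMeasure_map hm.aemeasurable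
  have h := isGreatest_otReg hc hlam (ζ.map (g θ)) ν
  have heq : ∀ ψ : Y → ℝ, MemLp ψ ∞ ν →
      ∫ x, softTransform c lam ν ψ x ∂(ζ.map (g θ)) = ∫ z, softTransform c lam ν ψ (g θ z) ∂ζ :=
    fun ψ hψ => integral_map hm.aemeasurable
      (continuous_softTransform hc hlam hψ).aestronglyMeasurable
  refine ⟨?_, ?_⟩
  · obtain ⟨ψ, hψ, hr⟩ := h.1
    rw [heq ψ hψ] at hr
    exact ⟨ψ, hψ, hr⟩
  · rintro _ ⟨ψ, hψ, rfl⟩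
    exact h.2 ⟨ψ, hψ, by rw [heq ψ hψ]; rfl⟩

theorem LipschitzGenerator.eventually_dualFun_sub_le [CompactSpace X] (hΘ : IsOpen Θ)
    (hg : LipschitzGenerator Θ ζ g L) (hc : IsLipschitzCost c κ) (hlam : 0 < lam)
    {θ : EuclideanSpace ℝ (Fin d)} (hθ : θ ∈ Θ) :
    ∀ᶠ θ' in 𝓝 θ, ∀ ψ : Y → ℝ, MemLp ψ ∞ ν →
      |dualFun c lam ζ ν g θ ψ - dualFun c lam ζ ν g θ' ψ|
        ≤ κ * (∫ z, L θ z ∂ζ) * ‖θ - θ'‖ := by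
  filter_upwards [hg.eventually_softTransform_sub_le (ν := ν) hc hlam hθ, hΘ.mem_nhds hθ]
    with θ' h hθ' ψ hψ
  unfold dualFun
  rw [add_sub_add_right_eq_sub, ← integral_sub (hg.integrable_softTransform hc hlam hθ hψ)
    (hg.integrable_softTransform hc hlam hθ' hψ), ← integral_const_mul, ← integral_mul_const]
  rw [← Real.norm_eq_abs]
  exact norm_integral_le_of_norm_le (((hg.integrable θ hθ).const_mul κ).mul_const _)
    (Eventually.of_forall fun z => h ψ hψ z)

/-- The pointwise Lipschitz estimate of the cost. -/
theorem LipschitzGenerator.eventually_genCost_sub_le [CompactSpace X] (hΘ : IsOpen Θ)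
    (hg : LipschitzGenerator Θ ζ g L) (hc : IsLipschitzCost c κ) (hlam : 0 < lam)
    {θ : EuclideanSpace ℝ (Fin d)} (hθ : θ ∈ Θ) :
    ∀ᶠ θ' in 𝓝 θ, |genCost c lam ζ ν g θ - genCost c lam ζ ν g θ'|
      ≤ κ * (∫ z, L θ z ∂ζ) * ‖θ - θ'‖ := by
  filter_upwards [hg.eventually_dualFun_sub_le (ν := ν) hΘ hc hlam hθ, hΘ.mem_nhds hθ]
    with θ' h hθ'
  -- A maximizer at either parameter is a competitor at the other, which bounds the difference from
  -- both sides.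
  obtain ⟨⟨ψ, hψ, h1⟩, h2⟩ := hg.isGreatest_genCost (ν := ν) hc hlam hθ
  obtain ⟨⟨ψ', hψ', h1'⟩, h2'⟩ := hg.isGreatest_genCost (ν := ν) hc hlam hθ'
  have h3 := h2 ⟨ψ', hψ', rfl⟩
  have h4 := h2' ⟨ψ, hψ, rfl⟩
  have h5 := abs_le.1 (h ψ hψ)
  have h6 := abs_le.1 (h ψ' hψ')
  rw [abs_le]
  constructor <;> linarith [h5.1, h5.2, h6.1, h6.2]

/-- The neighbourhood in the pointwise estimate varies with `θ`, so a two-point bound needs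
integration along segments of a ball on which the averaged constant is at most `M`. -/
theorem LipschitzGenerator.locallyLipschitzOn_genCost [CompactSpace X] (hΘ : IsOpen Θ)
    (hg : LipschitzGenerator Θ ζ g L) (hc : IsLipschitzCost c κ) (hlam : 0 < lam)
    (hL : ∀ θ₀ ∈ Θ, ∃ M : ℝ, ∀ᶠ θ in 𝓝 θ₀, ∫ z, L θ z ∂ζ ≤ M) :
    LocallyLipschitzOn Θ (genCost c lam ζ ν g) := by
  intro θ₀ hθ₀
  obtain ⟨M, hM⟩ := hL θ₀ hθ₀
  obtain ⟨ε, hε, hball⟩ := Metric.eventually_nhds_iff_ball.1 (hM.and (hΘ.mem_nhds hθ₀))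
  have hpt : ∀ θ ∈ Metric.ball θ₀ ε, ∀ᶠ θ' in 𝓝 θ,
      |genCost c lam ζ ν g θ - genCost c lam ζ ν g θ'| ≤ κ * M * ‖θ - θ'‖ := by
    intro θ hθ
    filter_upwards [hg.eventually_genCost_sub_le (ν := ν) hΘ hc hlam (hball θ hθ).2] with θ' h
    refine h.trans (mul_le_mul_of_nonneg_right ?_ (norm_nonneg _))
    exact mul_le_mul_of_nonneg_left (hball θ hθ).1 hc.1
  refine ⟨(κ * M).toNNReal, Metric.ball θ₀ ε,
    mem_nhdsWithin_of_mem_nhds (Metric.ball_mem_nhds _ hε), ?_⟩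
  refine LipschitzOnWith.of_dist_le' fun a ha b hb => ?_
  have h1 := abs_sub_le_of_pointwise (convex_ball θ₀ ε) hpt ha hb
  have h2 := abs_sub_le_of_pointwise (convex_ball θ₀ ε) hpt hb ha
  rw [Real.dist_eq, dist_eq_norm, abs_le]
  rw [norm_sub_rev] at h1
  constructor <;> linarith

end Cost

end Generator

/-! ### Differentiability and measurability with a parameter -/

section Parametric

variable {A E F : Type*} [TopologicalSpace A] [NormedAddCommGroup E] [InnerProductSpace ℝ E]
  [FiniteDimensional ℝ E] [NormedAddCommGroup F] [NormedSpace ℝ F]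

/-- A parametric function which is continuous over an open set of parameters agrees, near a given
parameter of this set, with a function which is continuous everywhere. -/
theorem exists_continuous_eventuallyEq {Θ : Set E} (hΘ : IsOpen Θ) {f : A → E → F}
    (hf : ∀ a, ∀ θ ∈ Θ, ContinuousAt (Function.uncurry f) (a, θ)) {θ₀ : E} (hθ₀ : θ₀ ∈ Θ) :
    ∃ f' : A → E → F, Continuous (Function.uncurry f') ∧ ∀ᶠ θ in 𝓝 θ₀, ∀ a, f' a θ = f a θ := by
  obtain ⟨ε, hε, hball⟩ := Metric.nhds_basis_closedBall.mem_iff.1 (hΘ.mem_nhds hθ₀)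
  -- The cutoff is `1` near `θ₀` and its closed support lies in `Θ`, so the product extends
  -- continuously by zero.
  let χ : ContDiffBump θ₀ := ⟨ε / 2, ε, by positivity, by linarith⟩
  refine ⟨fun a θ => χ θ • f a θ, continuous_iff_continuousAt.2 ?_, ?_⟩
  · rintro ⟨a, θ⟩
    by_cases hθ : θ ∈ Θ
    · exact (χ.continuous.continuousAt.comp continuousAt_snd).smul (hf a θ hθ)
    · have hnot : θ ∉ tsupport χ := by
        rw [χ.tsupport_eq]
        exact fun h => hθ (hball h)
      have hev : ∀ᶠ w : A × E in 𝓝 (a, θ), χ w.2 = 0 :=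
        (continuous_snd.tendsto (a, θ)).eventually (notMem_tsupport_iff_eventuallyEq.1 hnot)
      refine ContinuousAt.congr (f := fun _ => 0) continuousAt_const ?_
      filter_upwards [hev] with w hw
      simp [Function.uncurry, hw]
  · filter_upwards [χ.eventuallyEq_one] with θ hθ a
    simp [hθ]

/-- Agreement of germs is what transfers differentiability and derivatives from `f'` back to `f`. -/
theorem exists_continuous_eventuallyEq_nhds {Θ : Set E} (hΘ : IsOpen Θ) {f : A → E → F}
    (hf : ∀ a, ∀ θ ∈ Θ, ContinuousAt (Function.uncurry f) (a, θ)) {θ₀ : E} (hθ₀ : θ₀ ∈ Θ) :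
    ∃ f' : A → E → F, Continuous (Function.uncurry f') ∧
      ∃ B ⊆ Θ, IsOpen B ∧ θ₀ ∈ B ∧ ∀ θ ∈ B, ∀ a, f' a =ᶠ[𝓝 θ] f a := by
  obtain ⟨f', hf', hev⟩ := exists_continuous_eventuallyEq hΘ hf hθ₀
  obtain ⟨B, hB, hBo, hθB⟩ := eventually_nhds_iff.1 (hev.and (hΘ.mem_nhds hθ₀))
  exact ⟨f', hf', B, fun θ hθ => (hB θ hθ).2, hBo, hθB, fun θ hθ a => by
    filter_upwards [hBo.mem_nhds hθ] with θ' hθ' using (hB θ' hθ').1 a⟩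

/-- If each function `f a` is differentiable almost everywhere, then at almost every point almost
every function `f a` is differentiable. -/
theorem ae_ae_differentiableAt [MeasurableSpace A] [OpensMeasurableSpace A]
    [SecondCountableTopology A] [MeasurableSpace E] [BorelSpace E] [CompleteSpace F]
    {α : Measure A} [SFinite α] {μ : Measure E} [SFinite μ]
    {Θ : Set E} (hΘ : IsOpen Θ) {f : A → E → F}
    (hf : ∀ a, ∀ θ ∈ Θ, ContinuousAt (Function.uncurry f) (a, θ))
    (hd : ∀ a, ∀ᵐ θ ∂μ, θ ∈ Θ → DifferentiableAt ℝ (f a) θ) :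
    ∀ᵐ θ ∂(μ.restrict Θ), ∀ᵐ a ∂α, DifferentiableAt ℝ (f a) θ := by
  rw [ae_restrict_iff' hΘ.measurableSet, ae_iff]
  refine measure_null_of_locally_null _ fun θ₀ hθ₀ => ?_
  simp only [Classical.not_imp, Set.mem_ofPred_eq] at hθ₀
  obtain ⟨f', hf', B, hBΘ, hBo, hθB, hB⟩ := exists_continuous_eventuallyEq_nhds hΘ hf hθ₀.1
  have hmeas : MeasurableSet {w : A × E | w.2 ∈ B → DifferentiableAt ℝ (f' w.1) w.2} := by
    have h1 := measurableSet_of_differentiableAt_with_param ℝ hf'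
    have h2 : MeasurableSet {w : A × E | w.2 ∉ B} :=
      (hBo.measurableSet.preimage measurable_snd).compl
    have : {w : A × E | w.2 ∈ B → DifferentiableAt ℝ (f' w.1) w.2}
        = {w : A × E | w.2 ∉ B} ∪ {w : A × E | DifferentiableAt ℝ (f' w.1) w.2} := by
      ext w
      simp [imp_iff_not_or]
    rw [this]
    exact h2.union h1
  have hae : ∀ᵐ a ∂α, ∀ᵐ θ ∂μ, θ ∈ B → DifferentiableAt ℝ (f' a) θ := by
    refine Eventually.of_forall fun a => ?_
    filter_upwards [hd a] with θ h hθ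
    exact (h (hBΘ hθ)).congr_of_eventuallyEq (hB θ hθ a)
  -- Fubini exchanges the quantifiers; it needs the joint measurability `hmeas`, hence the globally
  -- continuous `f'`.
  rw [Measure.ae_ae_comm hmeas] at hae
  refine ⟨_, inter_mem_nhdsWithin _ (hBo.mem_nhds hθB), ?_⟩
  refine measure_mono_null ?_ (ae_iff.1 hae)
  rintro θ ⟨hθ, hθB⟩ h
  refine hθ fun _ => ?_
  filter_upwards [h] with a ha
  exact (ha hθB).congr_of_eventuallyEq (hB θ hθB a).symm

theorem aestronglyMeasurable_fderiv_with_param [MeasurableSpace A] [OpensMeasurableSpace A]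
    [SecondCountableTopology A] {α : Measure A} {Θ : Set E} (hΘ : IsOpen Θ) {f : A → E → ℝ}
    (hf : ∀ a, ∀ θ ∈ Θ, ContinuousAt (Function.uncurry f) (a, θ)) {θ : E} (hθ : θ ∈ Θ) :
    AEStronglyMeasurable (fun a => fderiv ℝ (f a) θ) α := by
  obtain ⟨f', hf', B, -, -, hθB, hB⟩ := exists_continuous_eventuallyEq_nhds hΘ hf hθ
  borelize E
  have h := ((measurable_fderiv_with_param ℝ hf').comp
    (measurable_prodMk_right (y := θ))).aestronglyMeasurable (μ := α)
  refine h.congr (Eventually.of_forall fun a => ?_)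
  exact (hB θ hθB a).fderiv_eq

end Parametric

/-! ### Almost everywhere differentiability and the envelope theorem -/

section Generator

variable {d m p q : ℕ} {Θ : Set (EuclideanSpace ℝ (Fin d))} {Z : Set (EuclideanSpace ℝ (Fin m))}
  {X : Set (EuclideanSpace ℝ (Fin p))} {ζ : Measure Z} {g : EuclideanSpace ℝ (Fin d) → Z → X}
  {L : EuclideanSpace ℝ (Fin d) → Z → ℝ}

/-- At almost every parameter, almost every trajectory of the generator is differentiable. -/
theorem LipschitzGenerator.ae_ae_differentiableAt [IsProbabilityMeasure ζ] (hΘ : IsOpen Θ)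
    (hg : LipschitzGenerator Θ ζ g L) :
    ∀ᵐ θ ∂(volume.restrict Θ), ∀ᵐ z ∂ζ,
      DifferentiableAt ℝ (fun θ' => (g θ' z : EuclideanSpace ℝ (Fin p))) θ := by
  refine RegOT.ae_ae_differentiableAt hΘ
    (f := fun z θ => (g θ z : EuclideanSpace ℝ (Fin p)))
    (fun z θ hθ => continuous_subtype_val.continuousAt.comp (hg.continuousAt hθ z)) fun z => ?_
  filter_upwards [ae_differentiableAt_of_pointwise_lipschitz_euclidean volume
    (fun θ => (g θ z : EuclideanSpace ℝ (Fin p)))] with θ h hθ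
  refine h ⟨L θ z, ?_⟩
  filter_upwards [hg.eventually_dist_le hθ] with θ' h'
  have := h' z
  rwa [Subtype.dist_eq, dist_eq_norm] at this

variable {Y : Set (EuclideanSpace ℝ (Fin q))} {ν : Measure Y} [IsProbabilityMeasure ν]
  [IsProbabilityMeasure ζ] {c : X → Y → ℝ} {lam κ : ℝ}

/-- Differentiation under the integral. The hypothesis `hd` does not involve `ψ`, so one null set of
parameters serves all potentials. -/
theorem LipschitzGenerator.differentiableAt_dualFun (hX : IsCompact X) (hY : IsCompact Y)
    (hΘ : IsOpen Θ) (hg : LipschitzGenerator Θ ζ g L) (hc : IsC1Cost X Y c) (hlam : 0 < lam)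
    {θ : EuclideanSpace ℝ (Fin d)} (hθ : θ ∈ Θ)
    (hd : ∀ᵐ z ∂ζ, DifferentiableAt ℝ (fun θ' => (g θ' z : EuclideanSpace ℝ (Fin p))) θ)
    {ψ : Y → ℝ} (hψ : MemLp ψ ∞ ν) :
    DifferentiableAt ℝ (fun θ' => dualFun c lam ζ ν g θ' ψ) θ := by
  have := isCompact_iff_compactSpace.1 hX
  have := isCompact_iff_compactSpace.1 hY
  obtain ⟨κ, hκ⟩ := hc.exists_isLipschitzCost hX hY
  have hev : ∀ᶠ θ' in 𝓝 θ, θ' ∈ Θ ∧ ∀ z,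
      ‖softTransform c lam ν ψ (g θ' z) - softTransform c lam ν ψ (g θ z)‖
        ≤ κ * L θ z * ‖θ' - θ‖ := by
    filter_upwards [hΘ.mem_nhds hθ, hg.eventually_softTransform_sub_le (ν := ν) hκ hlam hθ]
      with θ' h1 h2
    refine ⟨h1, fun z => ?_⟩
    rw [norm_sub_rev, norm_sub_rev θ']
    exact h2 ψ hψ z
  have h := hasFDerivAt_integral_of_dominated_loc_of_lip' (μ := ζ) (𝕜 := ℝ)
    (F := fun θ' z => softTransform c lam ν ψ (g θ' z))
    (F' := fun z => fderiv ℝ (fun θ' => softTransform c lam ν ψ (g θ' z)) θ)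
    (bound := fun z => κ * L θ z) (x₀ := θ) hev
    (fun θ' hθ' => (hg.integrable_softTransform hκ hlam hθ'.1 hψ).1)
    (hg.integrable_softTransform hκ hlam hθ hψ)
    (aestronglyMeasurable_fderiv_with_param hΘ
      (f := fun z θ' => softTransform c lam ν ψ (g θ' z))
      (fun z θ' hθ' => (continuous_softTransform hκ hlam hψ).continuousAt.comp
        (hg.continuousAt hθ' z)) hθ)
    (Eventually.of_forall fun z θ' hθ' => hθ'.2 z)
    ((hg.integrable θ hθ).const_mul κ)
    (by
      filter_upwards [hd] with z hz
      refine DifferentiableAt.hasFDerivAt ?_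
      -- `X` may have empty interior, so the chain rule goes through an extension `Ψ`, exact along
      -- the trajectory because `g` stays in `X`.
      obtain ⟨Ψ, hΨ, heq⟩ := hc.exists_differentiableAt_softTransform hY (lam := lam) hψ (g θ z)
      simp_rw [← heq]
      exact DifferentiableAt.comp (f := fun θ' => (g θ' z : EuclideanSpace ℝ (Fin p))) θ hΨ hz)
  exact h.2.differentiableAt.add_const _

/-- Stepanov's theorem is essential: the averaged constants need not be locally bounded here. -/
theorem LipschitzGenerator.ae_differentiableAt_genCost [CompactSpace X] [CompactSpace Y]
    (hΘ : IsOpen Θ) (hg : LipschitzGenerator Θ ζ g L) (hc : IsLipschitzCost c κ)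
    (hlam : 0 < lam) :
    ∀ᵐ θ ∂volume, θ ∈ Θ → DifferentiableAt ℝ (genCost c lam ζ ν g) θ := by
  filter_upwards [ae_differentiableAt_of_pointwise_lipschitz volume (genCost c lam ζ ν g)]
    with θ h hθ
  exact h ⟨_, hg.eventually_genCost_sub_le hΘ hc hlam hθ⟩

/-- The envelope theorem: the gradients of the cost and of the dual functional at a potential
agree where both exist. -/
theorem LipschitzGenerator.gradient_genCost_eq [CompactSpace X] [CompactSpace Y]
    (hΘ : IsOpen Θ) (hg : LipschitzGenerator Θ ζ g L) (hc : IsLipschitzCost c κ)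
    (hlam : 0 < lam) {θ : EuclideanSpace ℝ (Fin d)} (hθ : θ ∈ Θ) {ψ : Y → ℝ}
    (hψ : IsKantorovichPotential c lam ζ ν g θ ψ)
    (hW : DifferentiableAt ℝ (genCost c lam ζ ν g) θ)
    (hF : DifferentiableAt ℝ (fun θ' => dualFun c lam ζ ν g θ' ψ) θ) :
    gradient (genCost c lam ζ ν g) θ = gradient (fun θ' => dualFun c lam ζ ν g θ' ψ) θ := by
  have heq : genCost c lam ζ ν g θ = dualFun c lam ζ ν g θ ψ := by
    obtain ⟨⟨φ, hφ, h1⟩, h2⟩ := hg.isGreatest_genCost (ν := ν) hc hlam hθ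
    exact le_antisymm (h1 ▸ hψ.2 φ hφ) (h2 ⟨ψ, hψ.1, rfl⟩)
  -- `ψ` remains admissible at nearby parameters, so the difference is nonnegative, and it vanishes
  -- at `θ` by optimality.
  have hmin : IsLocalMin (fun θ' => genCost c lam ζ ν g θ' - dualFun c lam ζ ν g θ' ψ) θ := by
    filter_upwards [hΘ.mem_nhds hθ] with θ' hθ'
    rw [heq, sub_self, sub_nonneg]
    exact (hg.isGreatest_genCost (ν := ν) hc hlam hθ').2 ⟨ψ, hψ.1, rfl⟩
  have h := hmin.fderiv_eq_zero
  rw [fderiv_fun_sub hW hF, sub_eq_zero] at h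
  rw [gradient, gradient, h]

end Generator

end RegOT

theorem mainTheorem6 {d m p q : ℕ}
    (Θ : Set (EuclideanSpace ℝ (Fin d))) (hΘ : IsOpen Θ)
    (Z : Set (EuclideanSpace ℝ (Fin m)))
    (X : Set (EuclideanSpace ℝ (Fin p))) (hX : IsCompact X)
    (Y : Set (EuclideanSpace ℝ (Fin q))) (hY : IsCompact Y)
    (ζ : Measure Z) [IsProbabilityMeasure ζ]
    (ν : Measure Y) [IsProbabilityMeasure ν]
    (c : X → Y → ℝ) (hc : RegOT.IsC1Cost X Y c)
    (lam : ℝ) (hlam : 0 < lam)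
    (g : EuclideanSpace ℝ (Fin d) → Z → X)
    (L : EuclideanSpace ℝ (Fin d) → Z → ℝ)
    (hg : RegOT.LipschitzGenerator Θ ζ g L) :
    -- the cost is the maximum of the dual functional, which is attained
    (∀ θ ∈ Θ, IsGreatest {r : ℝ | ∃ ψ : Y → ℝ, MemLp ψ ∞ ν ∧ RegOT.dualFun c lam ζ ν g θ ψ = r}
      (RegOT.genCost c lam ζ ν g θ)) ∧
    -- the Lipschitz estimate around every parameter
    (∃ κ : ℝ, RegOT.IsLipschitzCost c κ) ∧
    (∀ κ : ℝ, RegOT.IsLipschitzCost c κ → ∀ θ₁ ∈ Θ, ∀ᶠ θ₂ in 𝓝 θ₁,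
      |RegOT.genCost c lam ζ ν g θ₁ - RegOT.genCost c lam ζ ν g θ₂|
        ≤ κ * (∫ z, L θ₁ z ∂ζ) * ‖θ₁ - θ₂‖) ∧
    -- locally Lipschitz, when the averaged constants are locally bounded
    ((∀ θ₀ ∈ Θ, ∃ M : ℝ, ∀ᶠ θ in 𝓝 θ₀, ∫ z, L θ z ∂ζ ≤ M) →
      LocallyLipschitzOn Θ (RegOT.genCost c lam ζ ν g)) ∧
    -- differentiability and the gradient formula at almost every parameter
    (∀ᵐ θ ∂(volume.restrict Θ),
      DifferentiableAt ℝ (RegOT.genCost c lam ζ ν g) θ ∧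
      ∀ ψ : Y → ℝ, RegOT.IsKantorovichPotential c lam ζ ν g θ ψ →
        DifferentiableAt ℝ (fun θ' => RegOT.dualFun c lam ζ ν g θ' ψ) θ ∧
        gradient (RegOT.genCost c lam ζ ν g) θ
          = gradient (fun θ' => RegOT.dualFun c lam ζ ν g θ' ψ) θ) := by
  have := isCompact_iff_compactSpace.1 hX
  have := isCompact_iff_compactSpace.1 hY
  obtain ⟨κ₀, hκ₀⟩ := hc.exists_isLipschitzCost hX hY
  refine ⟨fun θ hθ => hg.isGreatest_genCost hκ₀ hlam hθ, ⟨κ₀, hκ₀⟩,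
    fun κ hκ θ hθ => hg.eventually_genCost_sub_le hΘ hκ hlam hθ,
    fun hL => hg.locallyLipschitzOn_genCost hΘ hκ₀ hlam hL, ?_⟩
  filter_upwards [hg.ae_ae_differentiableAt hΘ, ae_restrict_mem hΘ.measurableSet,
    ae_restrict_of_ae (hg.ae_differentiableAt_genCost (ν := ν) hΘ hκ₀ hlam)] with θ hd hθ hW
  refine ⟨hW hθ, fun ψ hψ => ?_⟩
  have hF := hg.differentiableAt_dualFun hX hY hΘ hc hlam hθ hd hψ.1
  exact ⟨hF, hg.gradient_genCost_eq hΘ hκ₀ hlam hθ hψ (hW hθ) hF⟩
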